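/- **Bigraphs.** A \emph{bigraph} is a finite loopless multigraph in which every edge has a line style, solid or dotted. A symmetric quasi-Cartan matrix is a symmetric integer matrix $A$ with all diagonal entries equal to $2$; its bigraph $\mathbf G_A$ has the indices of $A$ as vertices, and distinct $i,j$ are joined by $|A_{ij}|$ edges, which are dotted if $A_{ij}>0$ and solid if $A_{ij}<0$. A bigraph $G$ with $n$ vertices has \emph{Dynkin type} $\mathbb A_n$ (resp. $\mathbb D_n$) if $G=\mathbf G_A$ for a symmetric quasi-Cartan matrix $A$ such that, for some numbering of the vertices by $1,\dots,n$, $M^{\mathrm T}AM$ is the Cartan matrix of type $\mathbb A_n$ (resp. $\mathbb D_n$) for some integer matrix $M$ that is invertible over $\mathbb Z$. A \emph{separation vertex} of $G$ is a vertex $s$ such that two vertices different from $s$ are joined by a path in $G$ but by no path in $G-s$. **$\mathbb D$-cycle gluings.** Let $H$ be a cycle bigraph with $h\ge 2$ distinct vertices $x_1,\dots,x_h$ and edges $e_1,\dots,e_h$, where $e_i$ joins $x_i$ and $x_{i+1}$ (with $x_{h+1}=x_1$), such that an odd number of the edges $e_i$ are dotted (for $h=2$ the edges $e_1,e_2$ are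 parallel). Let $F_1,\dots,F_h$ be bigraphs with vertex sets $V_1,\dots,V_h$ such that, for every $i$, 1. $F_i$ has Dynkin type $\mathbb A_{n_i}$ for some $n_i$; 2. $F_i$ contains the edge $e_i$ with the same line style as in $H$; 3. neither $x_i$ nor $x_{i+1}$ is a separation vertex of $F_i$; and such that $V_i\cap V_j=\{x_i,x_{i+1}\}\cap\{x_j,x_{j+1}\}$ for all $i\ne j$; that is, for $h\ge3$, $V_i\cap V_{i+1}=\{x_{i+1}\}$ for $1\le i<h$, $V_h\cap V_1=\{x_1\}$ and all other pairs are disjoint, while for $h=2$, $V_1\cap V_2=\{x_1,x_2\}$. The bigraph obtained from the union of $F_1,\dots,F_h$ (in which edges of different $F_i$ are different edges) by erasing pairs of parallel edges with opposite line styles is called the \emph{$\mathbb D$-cycle gluing} of $H$ and $F_1,\dots,F_h$. **Theorem.** Let $G$ be a bigraph with $n\ge4$ vertices. Then $G$ has Dynkin type $\mathbb D_n$ if and only if $G$ is a $\mathbb D$-cycle gluing of some such $H$ and $F_1,\dots,F_h$. -/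

import Mathlib

/-- The two line styles of the edges of a bigraph. -/
inductive LineStyle where
  | solid
  | dotted
  deriving DecidableEq

/-- The opposite line style. -/
def LineStyle.opposite : LineStyle → LineStyle
  | solid => dotted
  | dotted => solid

/-- A loopless multigraph with vertex set `V` whose edges carry a line style, given by its edge
multiplicities: `edges c u v` is the number of edges of line style `c` with endpoints `u`, `v`. -/
@[ext]
structure Bigraph (V : Type*) where
  edges : LineStyle → V → V → ℕ
  symm : ∀ c u v, edges c u v = edges c v u
  loopless : ∀ c v, edges c v v = 0

/-- A symmetric quasi-Cartan matrix with rows and columns indexed by `V`. -/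
def IsQuasiCartan {V : Type*} (A : Matrix V V ℤ) : Prop :=
  A.IsSymm ∧ ∀ v, A v v = 2

namespace Bigraph

open Classical in
/-- The bigraph of a symmetric quasi-Cartan matrix `A`: distinct vertices `u`, `v` are joined by
`|A u v|` edges, which are dotted if `A u v > 0` and solid otherwise. -/
noncomputable def ofMatrix {V : Type*} (A : Matrix V V ℤ) (hA : IsQuasiCartan A) : Bigraph V where
  edges c u v :=
    if u = v then 0
    else if 0 < A u v then (if c = LineStyle.dotted then (A u v).natAbs else 0)
    else (if c = LineStyle.solid then (A u v).natAbs else 0)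
  symm c u v := by
    rw [hA.1.apply u v]
    simp only [eq_comm]
  loopless c v := by simp

/-- `G` has the Dynkin type of the Cartan matrix `B`: `G` is the bigraph of a symmetric
quasi-Cartan matrix `A` which, after numbering the vertices, is `ℤ`-equivalent to `B`. -/
def HasDynkinType {V : Type*} (G : Bigraph V) {n : ℕ} (B : Matrix (Fin n) (Fin n) ℤ) : Prop :=
  ∃ (A : Matrix V V ℤ) (hA : IsQuasiCartan A), G = ofMatrix A hA ∧
    ∃ (e : V ≃ Fin n) (M : (Matrix (Fin n) (Fin n) ℤ)ˣ),
      B = (M : Matrix (Fin n) (Fin n) ℤ).transpose * A.reindex e e * (M : Matrix (Fin n) (Fin n) ℤ)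

/-- The simple graph in which two vertices are adjacent if some edge of `G` joins them. -/
def toSimpleGraph {V : Type*} (G : Bigraph V) : SimpleGraph V where
  Adj u v := ∃ c, 0 < G.edges c u v
  symm := ⟨fun u v ⟨c, hc⟩ => ⟨c, by rwa [G.symm c v u]⟩⟩
  loopless := ⟨fun v ⟨c, hc⟩ => by simp [G.loopless] at hc⟩

/-- `s` is a separation vertex of `G`: removing `s` disconnects two vertices that are connected
in `G`. -/
def IsSeparationVertex {V : Type*} (G : Bigraph V) (s : V) : Prop :=
  ∃ a b : ({s}ᶜ : Set V), G.toSimpleGraph.Reachable a b ∧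
    ¬ (G.toSimpleGraph.induce ({s}ᶜ : Set V)).Reachable a b

/-- Erase pairs of parallel edges with opposite line styles as long as there are any. In each
place the truncated difference of the two multiplicities remains. -/
def simplify {V : Type*} (G : Bigraph V) : Bigraph V where
  edges c u v := G.edges c u v - G.edges c.opposite u v
  symm c u v := by rw [G.symm c u v, G.symm c.opposite u v]
  loopless c v := by simp [G.loopless]

open Classical in
/-- The union of bigraphs `F i` whose vertex sets are the subsets `W i` of `V`; edges of
different `F i` are different edges of the union. -/
noncomputable def union {V ι : Type*} [Fintype ι] (W : ι → Set V) (F : ∀ i, Bigraph (W i)) :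
    Bigraph V where
  edges c u v :=
    ∑ i, if huv : u ∈ W i ∧ v ∈ W i then (F i).edges c ⟨u, huv.1⟩ ⟨v, huv.2⟩ else 0
  symm c u v := by
    refine Finset.sum_congr rfl fun i _ => ?_
    by_cases hu : u ∈ W i <;> by_cases hv : v ∈ W i <;> simp [hu, hv, (F i).symm c ⟨u, _⟩]
  loopless c v := by
    refine Finset.sum_eq_zero fun i _ => ?_
    split_ifs
    · exact (F i).loopless c _
    · rfl

end Bigraph

/-- A cycle bigraph with vertices `x i` in `V`, with `h ≥ 2` edges, the `i`-th of which joins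
`x i` to `x (i + 1)` (indices modulo `h`) and has line style `style i`, and with an odd number of
dotted edges. For `h = 2` the two edges are parallel. -/
structure OddCycle (V : Type*) where
  h : ℕ
  two_le : 2 ≤ h
  x : Fin h → V
  injective : Function.Injective x
  style : Fin h → LineStyle
  odd_dotted : Odd (Finset.univ.filter fun i => style i = LineStyle.dotted).card

/-- The vertex `x (i + 1)`, where `finRotate` is the cyclic successor on `Fin h`. -/
def OddCycle.next {V : Type*} (H : OddCycle V) (i : Fin H.h) : V :=
  H.x (finRotate H.h i)

/-- `G` is the `𝔻`-cycle gluing of `H` and the bigraphs `F i` with vertex sets `W i`. -/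
structure IsDCycleGluingOf {V : Type*} (G : Bigraph V) (H : OddCycle V)
    (W : Fin H.h → Set V) (F : ∀ i, Bigraph (W i)) : Prop where
  /-- each `F i` has Dynkin type `𝔸 m` for some `m` -/
  dynkin_A : ∀ i, ∃ m, (F i).HasDynkinType (CartanMatrix.A m)
  /-- `F i` contains the `i`-th edge of `H` with the same line style, and the endpoints of this
  edge are not separation vertices of `F i` -/
  cycle_edge : ∀ i, ∃ (hx : H.x i ∈ W i) (hy : H.next i ∈ W i),
    0 < (F i).edges (H.style i) ⟨H.x i, hx⟩ ⟨H.next i, hy⟩ ∧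
    ¬ (F i).IsSeparationVertex ⟨H.x i, hx⟩ ∧
    ¬ (F i).IsSeparationVertex ⟨H.next i, hy⟩
  /-- different `F i` share exactly the common endpoints of the corresponding edges of `H`: one
  vertex for consecutive edges and none otherwise if `h ≥ 3`, both vertices if `h = 2` -/
  inter : ∀ i j, i ≠ j →
    W i ∩ W j = ({H.x i, H.next i} : Set V) ∩ ({H.x j, H.next j} : Set V)
  /-- the `F i` cover all vertices of `G` -/
  cover : ⋃ i, W i = Set.univ
  eq_simplify : G = (Bigraph.union W F).simplify

/-- `G` is a `𝔻`-cycle gluing. -/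
def IsDCycleGluing {V : Type*} (G : Bigraph V) : Prop :=
  ∃ (H : OddCycle V) (W : Fin H.h → Set V) (F : ∀ i, Bigraph (W i)), IsDCycleGluingOf G H W F

/-! An integer vector of norm 2 has the form ±e_p ± e_q, so a realization of a bigraph by such
vectors is the incidence matrix of a signed graph whose edges are the vertices of the bigraph. For
type 𝔸 n this graph is a tree on n + 1 coordinates. For type 𝔻 n it is connected with n edges on n
coordinates, so it has one cycle, and this cycle is unbalanced: the product of its edge signs shows
that the rows are independent. A nonzero term of a determinant matches edges with endpoints; this
turns the tree into a parent map (`exists_treeMatrix_of_adj`) and the 𝔻-graph into a self-map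
(`exists_arrowMatrix_of_typeD`).

Root the tree of F_i at the coordinate shared by x_i and x_{i+1}. These two are not separation
vertices exactly when their edges end in leaves. A leaf coordinate occurs in one row only, so it
does not affect inner products of different rows. Delete these leaves and let x_{i+1} join the roots
of the trees of F_i and F_{i+1}: the roots now form a cycle, and off the diagonal the Gram matrices
of the trees add up (`glue_gram`), which is union followed by cancellation of opposite edges
(`simplify_union`).

A dotted e_i contributes the sign -1 to the cycle, so an odd number of dotted edges means an
unbalanced cycle. Running once around it puts 2e_p into the lattice (`single_two_mem_span`), and the
lattice becomes that of type 𝔻. Conversely, cutting the cycle edges of a 𝔻-graph gives the trees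
(`exists_treeCycle`); a balanced cycle is impossible because it would produce a kernel vector
(`exists_eq_mul_apply`). -/

namespace DCycle

open Matrix

/-! ### Realizations of Dynkin types by integer vectors -/

section Realization

variable {V P : Type*} [Fintype V] [Fintype P] {n : ℕ}

/-- A bigraph of the Dynkin type of the Gram matrix of `S` is realized by vectors `N v` that
generate the same lattice as the rows of `S`. -/
theorem exists_realization {B : Matrix (Fin n) (Fin n) ℤ} {S : Matrix (Fin n) P ℤ}
    (hS : S * Sᵀ = B) {G : Bigraph V} (h : G.HasDynkinType B) :
    ∃ N : Matrix V P ℤ, (∃ hA : IsQuasiCartan (N * Nᵀ), G = Bigraph.ofMatrix (N * Nᵀ) hA) ∧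
      (∃ M : Matrix V (Fin n) ℤ, N = M * S) ∧ (∃ M : Matrix (Fin n) V ℤ, S = M * N) ∧
      Fintype.card V = n := by
  classical
  obtain ⟨A, hA, hG, e, M, hB⟩ := h
  have hM : (M : Matrix (Fin n) (Fin n) ℤ) * (M⁻¹ : (Matrix (Fin n) (Fin n) ℤ)ˣ) = 1 := by simp
  have hM' : ((M⁻¹ : (Matrix (Fin n) (Fin n) ℤ)ˣ) : Matrix (Fin n) (Fin n) ℤ) * M = 1 := by simp
  set M₁ : Matrix (Fin n) (Fin n) ℤ := M.val with hM₁
  set M₂ : Matrix (Fin n) (Fin n) ℤ := M⁻¹.val with hM₂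
  have hT : M₁ᵀ * M₂ᵀ = 1 := by rw [← transpose_mul, hM', transpose_one]
  have hT' : M₂ᵀ * M₁ᵀ = 1 := by rw [← transpose_mul, hM, transpose_one]
  have hgram : (M₂ᵀ * S).submatrix e id * ((M₂ᵀ * S).submatrix e id)ᵀ = A := by
    have h1 : (M₂ᵀ * S) * (M₂ᵀ * S)ᵀ = A.reindex e e := by
      rw [transpose_mul, transpose_transpose, Matrix.mul_assoc, ← Matrix.mul_assoc S, hS, hB]
      calc M₂ᵀ * (M₁ᵀ * A.reindex e e * M₁ * M₂)
          = (M₂ᵀ * M₁ᵀ) * A.reindex e e * (M₁ * M₂) := by simp only [Matrix.mul_assoc]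
        _ = A.reindex e e := by rw [hT', hM, Matrix.one_mul, Matrix.mul_one]
    rw [transpose_submatrix, ← submatrix_mul _ _ e id e Function.bijective_id, h1]
    ext i j
    simp
  refine ⟨(M₂ᵀ * S).submatrix e id, ⟨hgram.symm ▸ hA, ?_⟩, ⟨M₂ᵀ.submatrix e id, ?_⟩,
    ⟨M₁ᵀ.submatrix id e, ?_⟩, by simpa using Fintype.card_congr e⟩
  · rw [hG]; congr 1; exact hgram.symm
  · ext i j; simp [Matrix.mul_apply]
  · rw [submatrix_mul_equiv M₁ᵀ (M₂ᵀ * S) id e id, ← Matrix.mul_assoc, hT, Matrix.one_mul]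
    rfl

/-- Independence of the rows of `S` turns the two expressions `N = M * S` and `S = M' * N` into `M'
* M = 1`, so the change of generators is unimodular. -/
theorem hasDynkinType_of_realization {B : Matrix (Fin n) (Fin n) ℤ} {S : Matrix (Fin n) P ℤ}
    (hS : S * Sᵀ = B) (hinj : ∀ X : Matrix (Fin n) (Fin n) ℤ, X * S = 0 → X = 0)
    {G : Bigraph V} {N : Matrix V P ℤ} {hA : IsQuasiCartan (N * Nᵀ)}
    (hG : G = Bigraph.ofMatrix (N * Nᵀ) hA) (hV : Fintype.card V = n)
    {M : Matrix V (Fin n) ℤ} (hM : N = M * S) {M' : Matrix (Fin n) V ℤ} (hM' : S = M' * N) :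
    G.HasDynkinType B := by
  classical
  let e : V ≃ Fin n := Fintype.equivFinOfCardEq hV
  have h1 : M' * M = 1 := by
    have : (M' * M - 1) * S = 0 := by
      rw [Matrix.sub_mul, Matrix.mul_assoc, ← hM, ← hM', Matrix.one_mul, sub_self]
    exact sub_eq_zero.1 (hinj _ this)
  have h2 : M'.submatrix id e.symm * M.submatrix e.symm id = 1 := by
    rw [submatrix_mul_equiv M' M id e.symm id, h1]; rfl
  have h3 : M.submatrix e.symm id * M'.submatrix id e.symm = 1 := mul_eq_one_comm.1 h2
  let U : (Matrix (Fin n) (Fin n) ℤ)ˣ :=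
    ⟨(M'.submatrix id e.symm)ᵀ, (M.submatrix e.symm id)ᵀ,
      by rw [← transpose_mul, h3, transpose_one], by rw [← transpose_mul, h2, transpose_one]⟩
  refine ⟨N * Nᵀ, hA, hG, e, U, ?_⟩
  have h4 : (U : Matrix (Fin n) (Fin n) ℤ) = (M'.submatrix id e.symm)ᵀ := rfl
  rw [h4, transpose_transpose, reindex_apply, submatrix_mul_equiv M' (N * Nᵀ) id e.symm e.symm,
    transpose_submatrix, submatrix_mul_equiv (M' * (N * Nᵀ)) M'ᵀ id e.symm id, ← hS]
  conv_lhs => rw [hM']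
  rw [transpose_mul, submatrix_id_id]
  simp only [Matrix.mul_assoc]

omit [Fintype V] [Fintype P] in
theorem exists_mul_of_rows_mem_span {Q : Type*} [Fintype Q] {S : Matrix Q P ℤ} {N : Matrix V P ℤ}
    (h : ∀ v, N v ∈ Submodule.span ℤ (Set.range S)) : ∃ M : Matrix V Q ℤ, N = M * S := by
  choose c hc using fun v => (Submodule.mem_span_range_iff_exists_fun ℤ).1 (h v)
  refine ⟨of c, ?_⟩
  ext v p
  rw [← hc v]
  simp [Matrix.mul_apply, Finset.sum_apply]

end Realization

/-! ### The simple roots of types `𝔸` and `𝔻` -/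

/-- The simple roots of type `𝔸 n` as rows of a matrix. -/
def rootA (n : ℕ) : Matrix (Fin n) (Fin (n + 1)) ℤ :=
  of fun i => Pi.single i.castSucc 1 - Pi.single i.succ 1

theorem rootA_mulVec {n : ℕ} (z : Fin (n + 1) → ℤ) (i : Fin n) :
    (rootA n *ᵥ z) i = z i.castSucc - z i.succ := by
  change (Pi.single i.castSucc 1 - Pi.single i.succ 1) ⬝ᵥ z = _
  simp [sub_dotProduct]

theorem rootA_gram (n : ℕ) : rootA n * (rootA n)ᵀ = CartanMatrix.A n := by
  ext i j
  have : (rootA n * (rootA n)ᵀ) i j = (rootA n *ᵥ rootA n j) i := rfl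
  rw [this, rootA_mulVec]
  simp only [rootA, of_apply, Pi.sub_apply, Pi.single_apply, CartanMatrix.A, Fin.ext_iff,
    Fin.val_castSucc, Fin.val_succ]
  split_ifs <;> omega

/-- This is connectedness in dual form; it later forces every parent chain to reach the root. -/
theorem const_of_rootA_mulVec {n : ℕ} {z : Fin (n + 1) → ℤ} (h : rootA n *ᵥ z = 0) (p q) :
    z p = z q := by
  have key : ∀ p, z p = z 0 := fun p => by
    induction p using Fin.induction with
    | zero => rfl
    | succ i ih =>
      have := congrFun h i
      rw [rootA_mulVec, Pi.zero_apply] at this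
      omega
  rw [key p, key q]

/-- Column `m` meets only the simple roots `m - 1` and `m`, so the coefficients of a vanishing
combination disappear one after another. -/
theorem rootA_left_cancel {n : ℕ} (X : Matrix (Fin n) (Fin n) ℤ) (h : X * rootA n = 0) : X = 0 := by
  ext k i
  have key : ∀ (z : Fin n → ℤ), z ᵥ* rootA n = 0 → ∀ m (hm : m < n), z ⟨m, hm⟩ = 0 := by
    intro z hz m
    have hz' : ∀ q : Fin (n + 1), ∑ i : Fin n,
        z i * ((if q = i.castSucc then 1 else 0) - (if q = i.succ then 1 else 0)) = 0 := by
      intro q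
      have := congrFun hz q
      simpa [vecMul, dotProduct, rootA, Pi.single_apply] using this
    induction m with
    | zero =>
      intro hm
      have := hz' 0
      rw [Finset.sum_eq_single ⟨0, hm⟩] at this
      · simpa [Fin.ext_iff] using this
      · intro b _ hb
        simp only [Fin.ext_iff, ne_eq] at hb ⊢
        simp [eq_comm, hb]
      · simp
    | succ m ih =>
      intro hm
      have h0 := ih (by omega)
      have := hz' ⟨m + 1, by omega⟩
      rw [Finset.sum_eq_single ⟨m + 1, hm⟩] at this
      · simpa [Fin.ext_iff] using this
      · intro b _ hb
        by_cases hbm : b = ⟨m, by omega⟩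
        · rw [hbm, h0, zero_mul]
        · simp only [ne_eq, Fin.ext_iff, Fin.val_castSucc, Fin.val_succ] at hb hbm ⊢
          have hb' : ¬ m + 1 = b.val := fun h => hb h.symm
          have hbm' : ¬ m = b.val := fun h => hbm h.symm
          simp [hb', hbm']
      · simp
  exact key (X k) (congrFun h k) i i.2

/-- The simple roots of type `𝔻 n` as rows of a matrix. -/
def rootD (n : ℕ) : Matrix (Fin n) (Fin n) ℤ :=
  of fun i => if h : i.val + 1 < n then Pi.single i 1 - Pi.single ⟨i.val + 1, h⟩ 1
    else Pi.single i 1 + Pi.single ⟨i.val - 1, by omega⟩ 1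

theorem rootD_apply_of_lt {n : ℕ} {i : Fin n} (h : i.val + 1 < n) :
    rootD n i = Pi.single i 1 - Pi.single ⟨i.val + 1, h⟩ 1 := dif_pos h

theorem rootD_apply_of_not_lt {n : ℕ} {i : Fin n} (h : ¬ i.val + 1 < n) :
    rootD n i = Pi.single i 1 + Pi.single ⟨i.val - 1, by omega⟩ 1 := dif_neg h

theorem rootD_mulVec {n : ℕ} (z : Fin n → ℤ) (i : Fin n) :
    (rootD n *ᵥ z) i = if h : i.val + 1 < n then z i - z ⟨i.val + 1, h⟩
      else z i + z ⟨i.val - 1, by omega⟩ := by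
  change rootD n i ⬝ᵥ z = _
  split_ifs with h
  · rw [rootD_apply_of_lt h]; simp [sub_dotProduct]
  · rw [rootD_apply_of_not_lt h]; simp [add_dotProduct]

theorem rootD_gram {n : ℕ} (hn : 3 ≤ n) : rootD n * (rootD n)ᵀ = CartanMatrix.D n := by
  ext i j
  have : (rootD n * (rootD n)ᵀ) i j = (rootD n *ᵥ rootD n j) i := rfl
  rw [this, rootD_mulVec]
  have hi := i.2
  have hj := j.2
  by_cases h1 : i.val + 1 < n <;> by_cases h2 : j.val + 1 < n <;>
    simp only [h1, h2, rootD_apply_of_lt, rootD_apply_of_not_lt, dite_true, dite_false,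
      Pi.sub_apply, Pi.add_apply, Pi.single_apply, CartanMatrix.D, Fin.ext_iff, of_apply,
      not_false_eq_true] <;> grind

/-- Used with `d = 0` for the kernel, and with `d = 2`, where signs no longer matter, as a test of
connectedness. -/
theorem modEq_of_rootD_mulVec {n : ℕ} {d : ℤ} {z : Fin n → ℤ} (h : ∀ i, d ∣ (rootD n *ᵥ z) i)
    (p q) : d ∣ z p - z q := by
  have key : ∀ m (hm : m < n), d ∣ z ⟨m, hm⟩ - z ⟨0, by omega⟩ := by
    intro m
    induction m with
    | zero => simp
    | succ m ih =>
      intro hm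
      have h1 := ih (by omega)
      have h2 := h ⟨m, by omega⟩
      rw [rootD_mulVec, dif_pos hm] at h2
      have := dvd_sub h1 h2
      simpa using this
  have := dvd_sub (key p p.2) (key q q.2)
  simpa using this

/-- The differences make `z` constant, and the last root, the only one with a plus sign, kills the
constant. -/
theorem eq_zero_of_rootD_mulVec {n : ℕ} {z : Fin n → ℤ} (h : rootD n *ᵥ z = 0) : z = 0 := by
  have hc : ∀ p q, z p = z q := fun p q => by
    have := modEq_of_rootD_mulVec (d := 0) (z := z) (fun i => by rw [h]; simp) p q
    rw [zero_dvd_iff] at this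
    omega
  ext p
  have hp := p.2
  have := congrFun h ⟨n - 1, by omega⟩
  rw [rootD_mulVec, dif_neg (show ¬ n - 1 + 1 < n by omega)] at this
  have h1 := hc ⟨n - 1, by omega⟩ p
  have h2 := hc ⟨n - 1 - 1, by omega⟩ p
  simp only [Pi.zero_apply] at this ⊢
  linarith

theorem rootD_left_cancel {n : ℕ} (X : Matrix (Fin n) (Fin n) ℤ) (h : X * rootD n = 0) : X = 0 := by
  have hdet : (rootD n).det ≠ 0 := fun h0 => by
    obtain ⟨v, hv, hv'⟩ := exists_mulVec_eq_zero_iff.2 h0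
    exact hv (eq_zero_of_rootD_mulVec hv')
  have : X * (rootD n * (rootD n).adjugate) = 0 := by rw [← Matrix.mul_assoc, h, Matrix.zero_mul]
  rw [mul_adjugate, Matrix.mul_smul, Matrix.mul_one] at this
  exact (smul_eq_zero.1 this).resolve_left hdet

/-! ### The root lattices of types `𝔸` and `𝔻` -/

section Lattice

variable {P : Type*} [Fintype P] [DecidableEq P]

/-- Modulo the differences with `p`, only the coordinate sum survives. Hence the 𝔸 lattice is given
by sum zero and the 𝔻 lattice by even sum. -/
theorem sum_smul_single_sub (z : P → ℤ) (p : P) :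
    z = ∑ q, z q • (Pi.single q 1 - Pi.single p 1 : P → ℤ) + (∑ q, z q) • Pi.single p 1 := by
  ext r
  simp [Finset.sum_apply, Pi.single_apply, mul_sub, Finset.sum_sub_distrib, Finset.sum_mul]

theorem mem_of_sum_eq_zero {L : Submodule ℤ (P → ℤ)} {p : P}
    (h : ∀ q, (Pi.single q 1 - Pi.single p 1 : P → ℤ) ∈ L) {z : P → ℤ} (hz : ∑ q, z q = 0) :
    z ∈ L := by
  rw [sum_smul_single_sub z p, hz, zero_smul, add_zero]
  exact L.sum_mem fun q _ => L.smul_mem _ (h q)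

theorem mem_of_even_sum {L : Submodule ℤ (P → ℤ)} {p : P}
    (h : ∀ q, (Pi.single q 1 - Pi.single p 1 : P → ℤ) ∈ L) (h2 : (Pi.single p 2 : P → ℤ) ∈ L)
    {z : P → ℤ} (hz : Even (∑ q, z q)) : z ∈ L := by
  obtain ⟨k, hk⟩ := hz
  rw [sum_smul_single_sub z p]
  refine L.add_mem (L.sum_mem fun q _ => L.smul_mem _ (h q)) ?_
  have : (∑ q, z q) • (Pi.single p 1 : P → ℤ) = k • Pi.single p 2 := by
    rw [hk, ← Pi.single_smul, ← Pi.single_smul]; congr 1; simp; ring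
  rw [this]
  exact L.smul_mem _ h2

end Lattice

theorem mem_span_rootA {n : ℕ} {z : Fin (n + 1) → ℤ} (hz : ∑ q, z q = 0) :
    z ∈ Submodule.span ℤ (Set.range (rootA n)) := by
  refine mem_of_sum_eq_zero (p := 0) (fun q => ?_) hz
  induction q using Fin.induction with
  | zero => simp
  | succ i ih =>
    have := Submodule.sub_mem _ ih (Submodule.subset_span (R := ℤ) ⟨i, rfl⟩)
    have h2 : rootA n i = Pi.single i.castSucc 1 - Pi.single i.succ 1 := rfl
    rw [h2] at this
    convert this using 1
    abel

theorem mem_span_rootD {n : ℕ} (hn : 2 ≤ n) {z : Fin n → ℤ} (hz : Even (∑ q, z q)) :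
    z ∈ Submodule.span ℤ (Set.range (rootD n)) := by
  have key : ∀ m (hm : m < n), (Pi.single ⟨m, hm⟩ 1 - Pi.single ⟨0, by omega⟩ 1 : Fin n → ℤ) ∈
      Submodule.span ℤ (Set.range (rootD n)) := by
    intro m
    induction m with
    | zero => simp
    | succ m ih =>
      intro hm
      have := Submodule.sub_mem _ (ih (by omega))
        (Submodule.subset_span (R := ℤ) ⟨⟨m, by omega⟩, rfl⟩)
      rw [rootD_apply_of_lt hm] at this
      convert this using 1
      abel
  refine mem_of_even_sum (p := ⟨n - 1, by omega⟩) (fun q => ?_) ?_ hz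
  · simpa using Submodule.sub_mem _ (key q q.2) (key (n - 1) (by omega))
  · have h1 := Submodule.sub_mem _ (key (n - 1) (by omega)) (key (n - 2) (by omega))
    have h2 := Submodule.add_mem _ h1
      (Submodule.subset_span (R := ℤ) (s := Set.range (rootD n)) ⟨⟨n - 1, by omega⟩, rfl⟩)
    convert h2 using 1
    have h3 : n - 1 - 1 = n - 2 := by omega
    have h4 : (Pi.single ⟨n - 1, by omega⟩ 2 : Fin n → ℤ) =
        Pi.single ⟨n - 1, by omega⟩ 1 + Pi.single ⟨n - 1, by omega⟩ 1 := by
      rw [← Pi.single_add]; norm_num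
    rw [rootD_apply_of_not_lt (show ¬ n - 1 + 1 < n by omega), h4]
    simp only [h3]
    abel

theorem sum_rootA {n : ℕ} (i : Fin n) : ∑ q, rootA n i q = 0 := by
  simp [rootA]

theorem even_sum_rootD {n : ℕ} (i : Fin n) : Even (∑ q, rootD n i q) := by
  by_cases h : i.val + 1 < n
  · simp [rootD_apply_of_lt h]
  · simp [rootD_apply_of_not_lt h, Finset.sum_add_distrib]

/-- An integer vector of norm `2` has exactly two nonzero entries, both equal to `±1`. -/
theorem exists_eq_single_add_single {P : Type*} [Fintype P] [DecidableEq P] {r : P → ℤ}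
    (h : r ⬝ᵥ r = 2) {p : P} (hp : r p ≠ 0) :
    ∃ a b q, q ≠ p ∧ a * a = 1 ∧ b * b = 1 ∧ r = Pi.single p a + Pi.single q b := by
  have h1 : r p * r p + ∑ q ∈ Finset.univ.erase p, r q * r q = 2 := by
    rw [Finset.add_sum_erase _ (fun q => r q * r q) (Finset.mem_univ p)]; exact h
  have hpos : ∀ s : Finset P, 0 ≤ ∑ q ∈ s, r q * r q :=
    fun s => Finset.sum_nonneg fun q _ => mul_self_nonneg _
  have sq_pos : ∀ q, r q ≠ 0 → 1 ≤ r q * r q := fun q hq => by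
    have := mul_self_pos.2 hq; omega
  have hp1 : r p * r p = 1 := by
    have h2 : r p * r p ≤ 2 := by have := hpos (Finset.univ.erase p); omega
    have h3 : r p ≤ 1 := by nlinarith
    have h4 : -1 ≤ r p := by nlinarith
    have h5 : r p = 1 ∨ r p = -1 := by omega
    rcases h5 with h5 | h5 <;> rw [h5] <;> norm_num
  obtain ⟨q, hq, hq0⟩ : ∃ q ∈ Finset.univ.erase p, r q ≠ 0 := by
    by_contra! hcon
    rw [Finset.sum_eq_zero fun q hq => by rw [hcon q hq, mul_zero], hp1] at h1
    omega
  rw [← Finset.add_sum_erase _ _ hq, hp1] at h1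
  have hq1 := sq_pos q hq0
  have hrest := hpos ((Finset.univ.erase p).erase q)
  have hz : ∑ t ∈ (Finset.univ.erase p).erase q, r t * r t = 0 := by omega
  rw [Finset.sum_eq_zero_iff_of_nonneg fun q _ => mul_self_nonneg _] at hz
  have hqp : q ≠ p := Finset.ne_of_mem_erase hq
  refine ⟨r p, r q, q, hqp, hp1, by omega, ?_⟩
  ext t
  simp only [Pi.add_apply, Pi.single_apply]
  by_cases htp : t = p
  · subst htp; simp [hqp.symm]
  by_cases htq : t = q
  · subst htq; simp [htp]
  have := hz t (by simp [htp, htq])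
  simpa [htp, htq] using this

/-- The matrix with the rows `a v • e (i v) + b v • e (f v)`. -/
def arrowMatrix {V P : Type*} [DecidableEq P] (i f : V → P) (a b : V → ℤ) : Matrix V P ℤ :=
  of fun v => Pi.single (i v) (a v) + Pi.single (f v) (b v)

/-! ### Incidence matrices of signed graphs -/

section arrowMatrix

variable {V P : Type*} [DecidableEq P] {i f : V → P} {a b : V → ℤ}

theorem arrowMatrix_row (v : V) :
    arrowMatrix i f a b v = Pi.single (i v) (a v) + Pi.single (f v) (b v) := rfl

theorem arrowMatrix_apply (v : V) (p : P) :
    arrowMatrix i f a b v p = (if p = i v then a v else 0) + if p = f v then b v else 0 := by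
  change (Pi.single (i v) (a v) + Pi.single (f v) (b v) : P → ℤ) p = _
  simp [Pi.single_apply]

variable [Fintype P]

theorem arrowMatrix_mulVec (z : P → ℤ) (v : V) :
    (arrowMatrix i f a b *ᵥ z) v = a v * z (i v) + b v * z (f v) := by
  change (Pi.single (i v) (a v) + Pi.single (f v) (b v)) ⬝ᵥ z = _
  simp [add_dotProduct]

omit [DecidableEq P] in
theorem isQuasiCartan_gram {N : Matrix V P ℤ} (h : ∀ v, N v ⬝ᵥ N v = 2) :
    IsQuasiCartan (N * Nᵀ) :=
  ⟨by simp [IsSymm, transpose_mul], h⟩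

theorem isQuasiCartan_arrowMatrix (hif : ∀ v, f v ≠ i v) (ha : ∀ v, a v * a v = 1)
    (hb : ∀ v, b v * b v = 1) :
    IsQuasiCartan (arrowMatrix i f a b * (arrowMatrix i f a b)ᵀ) := by
  refine isQuasiCartan_gram fun v => ?_
  have := arrowMatrix_mulVec (i := i) (f := f) (a := a) (b := b) (arrowMatrix i f a b v) v
  change (arrowMatrix i f a b *ᵥ (arrowMatrix i f a b v)) v = 2
  rw [this, arrowMatrix_row]
  simp [hif v, (hif v).symm, ha, hb]

end arrowMatrix

theorem ofMatrix_edges_pos {V : Type*} {A : Matrix V V ℤ} {hA : IsQuasiCartan A} {u v : V} :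
    (∃ c, 0 < (Bigraph.ofMatrix A hA).edges c u v) ↔ u ≠ v ∧ A u v ≠ 0 := by
  classical
  by_cases huv : u = v
  · simp [huv, Bigraph.loopless]
  · constructor
    · rintro ⟨c, hc⟩
      refine ⟨huv, fun h0 => ?_⟩
      simp [Bigraph.ofMatrix, h0] at hc
    · rintro ⟨-, h0⟩
      by_cases hpos : 0 < A u v
      · exact ⟨LineStyle.dotted, by simp [Bigraph.ofMatrix, huv, hpos, h0]⟩
      · exact ⟨LineStyle.solid, by simp [Bigraph.ofMatrix, huv, hpos, h0]⟩

/-! ### Bigraphs of type `𝔸` and rooted trees -/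

section TypeA

variable {W : Type*} [Fintype W] [DecidableEq W]

/-- The matrix of a rooted tree whose non-root vertices are identified with the edges towards the
parent: `f w` is the parent of `w`, and `none` is the root. -/
abbrev treeMatrix (f : W → Option W) (a b : W → ℤ) : Matrix W (Option W) ℤ :=
  arrowMatrix some f a b

omit [Fintype W] [DecidableEq W] in
theorem parent_ne {f : W → Option W} (wf : WellFounded fun u w => f w = some u) (w : W) :
    f w ≠ some w := fun h => wf.irrefl.irrefl w h

/-- Without the column `none` the matrix is nonsingular, since a kernel vector extended by 0 is
constant. A nonzero term of the determinant is the required matching. -/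
theorem exists_perm_of_kernel {N : Matrix W (Option W) ℤ}
    (hker : ∀ z, N *ᵥ z = 0 → ∀ p q, z p = z q) :
    ∃ σ : Equiv.Perm W, ∀ w, N w (some (σ w)) ≠ 0 := by
  have hdet : (of fun v w => N v (some w) : Matrix W W ℤ).det ≠ 0 := fun h0 => by
    obtain ⟨v, hv, hv'⟩ := exists_mulVec_eq_zero_iff.2 h0
    have h1 : N *ᵥ (fun q => q.elim 0 v) = 0 := by
      ext w
      have := congrFun hv' w
      simpa [mulVec, dotProduct, Fintype.sum_option] using this
    exact hv (funext fun w => hker _ h1 (some w) none)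
  rw [det_apply] at hdet
  obtain ⟨σ, -, hσ⟩ := Finset.exists_ne_zero_of_sum_ne_zero hdet
  have h2 : ∏ i, N (σ i) (some i) ≠ 0 := fun h0 => hσ (by simp [h0])
  refine ⟨σ⁻¹, fun w => ?_⟩
  have := Finset.prod_ne_zero_iff.1 h2 (σ⁻¹ w) (Finset.mem_univ _)
  simpa using this

/-- Adjacent `x` and `y` share a coordinate, which is taken as the root. The matching of
`exists_perm_of_kernel` names every other coordinate after an edge at it, and the other end of that
edge is the parent. -/
theorem exists_treeMatrix_of_adj {F : Bigraph W} {m : ℕ}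
    (h : F.HasDynkinType (CartanMatrix.A m)) {x y : W} (hxy : ∃ c, 0 < F.edges c x y) :
    ∃ (f : W → Option W) (a b : W → ℤ), (∀ w, a w * a w = 1) ∧ (∀ w, b w * b w = 1) ∧
      WellFounded (fun u w => f w = some u) ∧ f x = none ∧ f y = none ∧
      ∃ hA : IsQuasiCartan (treeMatrix f a b * (treeMatrix f a b)ᵀ),
        F = Bigraph.ofMatrix (treeMatrix f a b * (treeMatrix f a b)ᵀ) hA := by
  obtain ⟨N, ⟨hA, hF⟩, ⟨M, hM⟩, ⟨M', hM'⟩, hcard⟩ := exists_realization (rootA_gram m) h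
  rw [hF, ofMatrix_edges_pos] at hxy
  obtain ⟨p, -, hp⟩ : ∃ p ∈ Finset.univ, N x p * N y p ≠ 0 :=
    Finset.exists_ne_zero_of_sum_ne_zero hxy.2
  have hcard' : Fintype.card W = Fintype.card {q // q ≠ p} := by
    rw [Fintype.card_subtype_compl]; simp [hcard]
  let τ₀ : Option W ≃ Fin (m + 1) :=
    (Equiv.optionCongr (Fintype.equivOfCardEq hcard')).trans (Equiv.optionSubtypeNe p)
  have hτ₀ : τ₀ none = p := by simp [τ₀]
  have hker₀ : ∀ z, N *ᵥ z = 0 → ∀ p q, z p = z q := fun z hz =>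
    const_of_rootA_mulVec (by rw [hM', ← mulVec_mulVec, hz, mulVec_zero])
  have hker : ∀ τ : Option W ≃ Fin (m + 1), ∀ z, N.submatrix id τ *ᵥ z = 0 →
      ∀ p q, z p = z q := by
    intro τ z hz p q
    rw [submatrix_mulVec_equiv] at hz
    simpa using hker₀ _ hz (τ p) (τ q)
  obtain ⟨σ, hσ⟩ := exists_perm_of_kernel (hker τ₀)
  let τ : Option W ≃ Fin (m + 1) := (Equiv.optionCongr σ).trans τ₀
  have hτ : τ none = p := by simp [τ, hτ₀]
  have hτw : ∀ w, N w (τ (some w)) ≠ 0 := hσ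
  have hgram : (N.submatrix id τ) * (N.submatrix id τ)ᵀ = N * Nᵀ := by
    rw [transpose_submatrix, submatrix_mul_equiv N Nᵀ id τ id, submatrix_id_id]
  have hrow : ∀ w, ∃ a b q, q ≠ some w ∧ a * a = 1 ∧ b * b = 1 ∧
      (N.submatrix id τ) w = Pi.single (some w) a + Pi.single q b := fun w => by
    refine exists_eq_single_add_single ?_ (hτw w)
    have := hA.2 w
    rw [← hgram] at this
    exact this
  choose a b f hf ha hb hN using hrow
  have hNt : N.submatrix id τ = treeMatrix f a b := by
    ext w q; rw [hN]; rfl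
  -- The rows lie in the lattice of vectors with sum zero, so the two signs are opposite.
  have hsum : ∀ w, a w + b w = 0 := fun w => by
    have h1 : ∑ q, N w q = 0 := by
      have h2 : (N *ᵥ 1) w = 0 := by
        rw [hM, ← mulVec_mulVec]
        have : rootA m *ᵥ 1 = 0 := by ext i; rw [rootA_mulVec]; simp
        rw [this, mulVec_zero, Pi.zero_apply]
      simpa [mulVec, dotProduct] using h2
    have h3 : ∑ q, (N.submatrix id τ) w q = 0 := by
      rw [← h1]; exact τ.sum_comp (N w)
    rw [hN w] at h3
    simpa [Finset.sum_add_distrib] using h3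
  refine ⟨f, a, b, ha, hb, ?_, ?_, ?_, by rw [← hNt, hgram]; exact hA, ?_⟩
  · refine ⟨fun w => ?_⟩
    classical
    -- The indicator of the edges whose parent chain never ends takes equal values at both ends of
    -- each edge. It lies in the kernel, so it equals its value 0 at the root.
    let z : Option W → ℤ := fun q => q.elim 0 fun w =>
      if Acc (fun u w => f w = some u) w then 0 else 1
    have hz : ∀ w, z (some w) = z (f w) := by
      intro w
      cases hfw : f w with
      | none =>
        have : Acc (fun u w => f w = some u) w := ⟨w, fun u hu => by simp [hfw] at hu⟩
        simp [z, this]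
      | some u =>
        have : Acc (fun u w => f w = some u) w ↔ Acc (fun u w => f w = some u) u := by
          refine ⟨fun h => h.inv hfw, fun h => ⟨w, fun u' hu' => ?_⟩⟩
          rw [hfw, Option.some.injEq] at hu'
          exact hu' ▸ h
        simp [z, this]
    have h0 : N.submatrix id τ *ᵥ z = 0 := by
      ext w
      rw [hNt, arrowMatrix_mulVec, ← hz, ← add_mul, hsum, zero_mul, Pi.zero_apply]
    have := hker τ z h0 (some w) none
    by_contra hacc
    simp [z, hacc] at this
  · by_contra hne
    have : N.submatrix id τ x none = 0 := by
      rw [hN x]; simp [Ne.symm hne]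
    rw [submatrix_apply, hτ, id] at this
    simp [this] at hp
  · by_contra hne
    have : N.submatrix id τ y none = 0 := by
      rw [hN y]; simp [Ne.symm hne]
    rw [submatrix_apply, hτ, id] at this
    simp [this] at hp
  · rw [hF]
    congr 1
    rw [← hNt, hgram]

-- Trees are balanced: signs chosen from the root outwards turn each row into plus or minus a
-- difference of child and parent.
omit [Fintype W] [DecidableEq W] in
theorem exists_switching {f : W → Option W} {a b : W → ℤ} (ha : ∀ w, a w * a w = 1)
    (hb : ∀ w, b w * b w = 1) (wf : WellFounded fun u w => f w = some u) :
    ∃ ε : Option W → ℤ, (∀ q, ε q * ε q = 1) ∧ ∀ w, b w * ε (f w) = -(a w * ε (some w)) := by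
  let ε₀ : W → ℤ := wf.fix fun w ih =>
    match hw : f w with
    | none => -(a w * b w)
    | some u => -(a w * b w * ih u hw)
  have h₀ : ∀ w, ε₀ w = -(a w * b w * (f w).elim 1 ε₀) := by
    intro w
    simp only [ε₀]
    rw [wf.fix_eq]
    split <;> rename_i hw <;> simp [hw]
  have hsq : ∀ w, ε₀ w * ε₀ w = 1 := by
    intro w
    induction w using wf.induction with
    | _ w ih =>
      rw [h₀]
      cases hw : f w with
      | none =>
        simp only [Option.elim]
        linear_combination (b w * b w) * ha w + hb w
      | some u =>
        simp only [Option.elim]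
        linear_combination (b w * b w * ε₀ u * ε₀ u) * ha w + (ε₀ u * ε₀ u) * hb w + ih u hw
  refine ⟨fun q => q.elim 1 ε₀, fun q => ?_, fun w => ?_⟩
  · cases q <;> simp [hsq]
  · change _ = -(a w * ε₀ w)
    rw [h₀ w]
    linear_combination -(b w * (f w).elim 1 ε₀) * ha w

/-- After switching, the rows telescope along parent chains to all differences with the root, which
generate the 𝔸 lattice. -/
theorem hasDynkinType_treeMatrix {f : W → Option W} {a b : W → ℤ} (ha : ∀ w, a w * a w = 1)
    (hb : ∀ w, b w * b w = 1) (wf : WellFounded fun u w => f w = some u)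
    (hA : IsQuasiCartan (treeMatrix f a b * (treeMatrix f a b)ᵀ)) :
    (Bigraph.ofMatrix _ hA).HasDynkinType (CartanMatrix.A (Fintype.card W)) := by
  obtain ⟨ε, hε, hεf⟩ := exists_switching ha hb wf
  let τ : Option W ≃ Fin (Fintype.card W + 1) := Fintype.equivFinOfCardEq (by simp)
  let c : W → ℤ := fun w => a w * ε (some w)
  let N : Matrix W (Fin (Fintype.card W + 1)) ℤ :=
    of fun w => c w • (Pi.single (τ (some w)) 1 - Pi.single (τ (f w)) 1)
  have hNrow : ∀ w, N w = c w • (Pi.single (τ (some w)) 1 - Pi.single (τ (f w)) 1) :=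
    fun w => rfl
  have hNe : ∀ w q, N w (τ q) = treeMatrix f a b w q * ε q := by
    intro w q
    rw [hNrow, treeMatrix, arrowMatrix_apply]
    simp only [Pi.smul_apply, Pi.sub_apply, Pi.single_apply, smul_eq_mul,
      EmbeddingLike.apply_eq_iff_eq, c]
    have := hεf w
    by_cases h1 : q = some w <;> by_cases h2 : q = f w <;> simp only [h1, h2, if_true, if_false]
    · have h3 := h1.symm.trans h2
      exact absurd h3.symm (parent_ne wf w)
    · simp [← h1, h2]
    · simp only [← h2, h1, if_false] at this ⊢
      linear_combination -this
    · simp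
  have hgram : treeMatrix f a b * (treeMatrix f a b)ᵀ = N * Nᵀ := by
    ext u v
    simp only [Matrix.mul_apply, transpose_apply]
    rw [← τ.sum_comp]
    refine Finset.sum_congr rfl fun q _ => ?_
    rw [hNe, hNe]
    linear_combination -(treeMatrix f a b u q * treeMatrix f a b v q) * hε q
  have hL : ∀ w, (Pi.single (τ (some w)) 1 - Pi.single (τ none) 1 : Fin _ → ℤ) ∈
      Submodule.span ℤ (Set.range N) := by
    have hstep : ∀ w, (Pi.single (τ (some w)) 1 - Pi.single (τ (f w)) 1 : Fin _ → ℤ) ∈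
        Submodule.span ℤ (Set.range N) := by
      intro w
      have hc : c w * c w = 1 := by
        simp only [c]
        linear_combination (ε (some w) * ε (some w)) * ha w + hε (some w)
      have := Submodule.smul_mem _ (c w)
        (Submodule.subset_span (R := ℤ) (s := Set.range N) ⟨w, rfl⟩)
      rwa [hNrow, smul_smul, hc, one_smul] at this
    intro w
    induction w using wf.induction with
    | _ w ih =>
      have h1 := hstep w
      cases hw : f w with
      | none => rwa [hw] at h1
      | some u =>
        rw [hw] at h1
        have := Submodule.add_mem _ h1 (ih u hw)
        rwa [sub_add_sub_cancel] at this
  obtain ⟨M, hM⟩ : ∃ M, N = M * rootA (Fintype.card W) :=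
    exists_mul_of_rows_mem_span fun w => mem_span_rootA (by simp [hNrow, ← Finset.mul_sum])
  obtain ⟨M', hM'⟩ : ∃ M', rootA (Fintype.card W) = M' * N :=
    exists_mul_of_rows_mem_span fun i => mem_of_sum_eq_zero (p := τ none) (fun q => by
      obtain ⟨q, rfl⟩ := τ.surjective q
      cases q with
      | none => simp
      | some w => exact hL w) (sum_rootA i)
  exact hasDynkinType_of_realization (rootA_gram _) rootA_left_cancel (hA := hgram ▸ hA)
    (by congr 1) rfl hM hM'

end TypeA

/-! ### Adjacency and separation vertices in bigraphs of type `𝔸` -/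

section Separation

variable {W : Type*} [Fintype W] [DecidableEq W] {f : W → Option W} {a b : W → ℤ}

theorem treeMatrix_gram (u v : W) : (treeMatrix f a b * (treeMatrix f a b)ᵀ) u v =
    a u * ((if u = v then a v else 0) + if some u = f v then b v else 0) +
      b u * ((if f u = some v then a v else 0) + if f u = f v then b v else 0) := by
  have h1 : (treeMatrix f a b * (treeMatrix f a b)ᵀ) u v =
      (treeMatrix f a b *ᵥ (treeMatrix f a b v)) u := rfl
  rw [h1, arrowMatrix_mulVec, treeMatrix, arrowMatrix_apply, arrowMatrix_apply]
  simp

/-- Different edges of a tree share at most one coordinate, so no cancellation occurs in the inner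
product. -/
theorem treeMatrix_gram_ne_zero (ha : ∀ w, a w * a w = 1) (hb : ∀ w, b w * b w = 1)
    (wf : WellFounded fun u w => f w = some u) {u v : W} (huv : u ≠ v) :
    (treeMatrix f a b * (treeMatrix f a b)ᵀ) u v ≠ 0 ↔
      f v = some u ∨ f u = some v ∨ f u = f v := by
  have hna : ∀ w, a w ≠ 0 := fun w h => by simpa [h] using ha w
  have hnb : ∀ w, b w ≠ 0 := fun w h => by simpa [h] using hb w
  rw [treeMatrix_gram]
  by_cases h1 : f v = some u
  · have h2 : f u ≠ some v := fun h => wf.asymmetric _ _ h h1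
    have h3 : f u ≠ f v := fun h => parent_ne wf u (h.trans h1)
    simp [huv, h1, h2, hna, hnb, parent_ne wf u]
  · by_cases h2 : f u = some v
    · have h3 : f u ≠ f v := fun h => parent_ne wf v (h.symm.trans h2)
      simp [huv, h2, Ne.symm h1, hna, hnb, (parent_ne wf v).symm]
    · by_cases h3 : f u = f v
      · have h4 : some u ≠ f v := fun h => h1 h.symm
        have h5 : f v ≠ some v := parent_ne wf v
        simp [huv, h3, h4, h5, hnb]
      · simp [huv, Ne.symm h1, h2, h3, h1]

variable (hA : IsQuasiCartan (treeMatrix f a b * (treeMatrix f a b)ᵀ))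

include hA in
theorem tree_adj (ha : ∀ w, a w * a w = 1) (hb : ∀ w, b w * b w = 1)
    (wf : WellFounded fun u w => f w = some u) (u v : W) :
    (Bigraph.ofMatrix _ hA).toSimpleGraph.Adj u v ↔
      u ≠ v ∧ (f v = some u ∨ f u = some v ∨ f u = f v) := by
  refine ofMatrix_edges_pos.trans (and_congr_right fun huv => ?_)
  exact treeMatrix_gram_ne_zero ha hb wf huv

/-- If something hangs below `x`, removing `x` cuts its descendants off from `y`, which is another
edge at the root. -/
theorem parent_ne_of_not_isSeparationVertex (ha : ∀ w, a w * a w = 1) (hb : ∀ w, b w * b w = 1)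
    (wf : WellFounded fun u w => f w = some u) {x y : W} (hxy : x ≠ y) (hx : f x = none)
    (hy : f y = none) (hsep : ¬ (Bigraph.ofMatrix _ hA).IsSeparationVertex x) (v : W) :
    f v ≠ some x := by
  intro hv
  have hadj := tree_adj hA ha hb wf
  have hvx : v ≠ x := fun h => parent_ne wf v (h ▸ hv)
  refine hsep ⟨⟨v, hvx⟩, ⟨y, hxy.symm⟩, ?_, ?_⟩
  · have h1 : (Bigraph.ofMatrix _ hA).toSimpleGraph.Adj v x :=
      (hadj v x).2 ⟨hvx, .inr (.inl hv)⟩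
    have h2 : (Bigraph.ofMatrix _ hA).toSimpleGraph.Adj x y :=
      (hadj x y).2 ⟨hxy, .inr (.inr (hx.trans hy.symm))⟩
    exact h1.reachable.trans h2.reachable
  -- `D` contains `x` itself, so every other member of `D` has its parent in `D`.
  · let D : W → Prop := fun w => Relation.ReflTransGen (fun u w => f w = some u) x w
    have hDx : ∀ w, D w → w ≠ x → ∃ u, f w = some u ∧ D u := by
      intro w hw hne
      rcases Relation.ReflTransGen.cases_tail hw with h | ⟨u, hu, huw⟩
      · exact absurd h hne
      · exact ⟨u, huw, hu⟩
    have step : ∀ p q : ({x}ᶜ : Set W),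
        ((Bigraph.ofMatrix _ hA).toSimpleGraph.induce ({x}ᶜ : Set W)).Adj p q → D p → D q := by
      intro p q hpq hp
      obtain ⟨-, h | h | h⟩ := (hadj p q).1 hpq
      · exact hp.tail h
      · obtain ⟨u, hu, hu'⟩ := hDx p hp p.2
        rw [h, Option.some.injEq] at hu
        exact hu ▸ hu'
      · obtain ⟨u, hu, hu'⟩ := hDx p hp p.2
        exact hu'.tail (h.symm.trans hu)
    intro hreach
    rw [SimpleGraph.reachable_iff_reflTransGen] at hreach
    have hDy : D y := by
      have : ∀ q : ({x}ᶜ : Set W), Relation.ReflTransGen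
          ((Bigraph.ofMatrix _ hA).toSimpleGraph.induce ({x}ᶜ : Set W)).Adj ⟨v, hvx⟩ q → D q := by
        intro q hq
        induction hq with
        | refl => exact .single hv
        | tail _ h ih => exact step _ _ h ih
      exact this _ hreach
    obtain ⟨u, hu, -⟩ := hDx y hDy hxy.symm
    simp [hy] at hu

/-- Parent chains starting outside `x` avoid `x` and end at an edge at the root, which is `y` or
adjacent to `y`. -/
theorem not_isSeparationVertex_of_parent_ne (ha : ∀ w, a w * a w = 1)
    (hb : ∀ w, b w * b w = 1) (wf : WellFounded fun u w => f w = some u) {x y : W}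
    (hxy : x ≠ y) (hy : f y = none) (hx : ∀ v, f v ≠ some x) :
    ¬ (Bigraph.ofMatrix _ hA).IsSeparationVertex x := by
  have hadj := tree_adj hA ha hb wf
  have key : ∀ w (hw : w ≠ x), ((Bigraph.ofMatrix _ hA).toSimpleGraph.induce
      ({x}ᶜ : Set W)).Reachable ⟨w, hw⟩ ⟨y, hxy.symm⟩ := by
    intro w
    induction w using wf.induction with
    | _ w ih =>
      intro hw
      by_cases hwy : w = y
      · subst hwy; rfl
      · cases hfw : f w with
        | none =>
          refine SimpleGraph.Adj.reachable ?_
          exact (hadj w y).2 ⟨hwy, .inr (.inr (hfw.trans hy.symm))⟩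
        | some u =>
          have hux : u ≠ x := fun h => hx w (h ▸ hfw)
          refine SimpleGraph.Reachable.trans (SimpleGraph.Adj.reachable ?_) (ih u hfw hux)
          exact (hadj w u).2 ⟨fun h => parent_ne wf w (h ▸ hfw), .inr (.inl hfw)⟩
  rintro ⟨p, q, -, hpq⟩
  exact hpq ((key p p.2).trans (key q q.2).symm)

end Separation

/-! ### Bigraphs of type `𝔻` and functional graphs -/

section TypeD

variable {V : Type*} [Fintype V] [DecidableEq V]

/-- The realization is nonsingular, and a nonzero determinant term names each coordinate after an
edge at it; `f` gives the other end. The condition on `S` is connectedness, and the kernel condition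
will exclude a balanced cycle. -/
theorem exists_arrowMatrix_of_typeD {n : ℕ} (hn : 3 ≤ n) {G : Bigraph V}
    (h : G.HasDynkinType (CartanMatrix.D n)) :
    ∃ (f : V → V) (a b : V → ℤ), (∀ v, a v * a v = 1) ∧ (∀ v, b v * b v = 1) ∧
      (∀ v, f v ≠ v) ∧ (∀ S : Set V, (∀ v, v ∈ S ↔ f v ∈ S) → ∀ u v, u ∈ S → v ∈ S) ∧
      (∀ z : V → ℤ, (∀ v, a v * z v + b v * z (f v) = 0) → z = 0) ∧
      ∃ hA : IsQuasiCartan (arrowMatrix id f a b * (arrowMatrix id f a b)ᵀ),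
        G = Bigraph.ofMatrix (arrowMatrix id f a b * (arrowMatrix id f a b)ᵀ) hA := by
  obtain ⟨N, ⟨hA, hG⟩, -, ⟨M', hM'⟩, hcard⟩ := exists_realization (rootD_gram hn) h
  let τ₀ : V ≃ Fin n := Fintype.equivFinOfCardEq hcard
  have hker₀ : ∀ z, N *ᵥ z = 0 → z = 0 := fun z hz =>
    eq_zero_of_rootD_mulVec (by rw [hM', ← mulVec_mulVec, hz, mulVec_zero])
  have hdet : (N.submatrix id τ₀).det ≠ 0 := fun h0 => by
    obtain ⟨v, hv, hv'⟩ := exists_mulVec_eq_zero_iff.2 h0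
    rw [submatrix_mulVec_equiv] at hv'
    refine hv (funext fun p => ?_)
    simpa using congrFun (hker₀ _ hv') (τ₀ p)
  rw [det_apply] at hdet
  obtain ⟨σ, -, hσ⟩ := Finset.exists_ne_zero_of_sum_ne_zero hdet
  have hσ' : ∏ i, N.submatrix id τ₀ (σ i) i ≠ 0 := fun h0 => hσ (by rw [h0, smul_zero])
  let τ : V ≃ Fin n := σ⁻¹.trans τ₀
  have hτ : ∀ v, N v (τ v) ≠ 0 := fun v => by
    simpa [τ] using Finset.prod_ne_zero_iff.1 hσ' (σ⁻¹ v) (Finset.mem_univ _)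
  have hgram : (N.submatrix id τ) * (N.submatrix id τ)ᵀ = N * Nᵀ := by
    rw [transpose_submatrix, submatrix_mul_equiv N Nᵀ id τ id, submatrix_id_id]
  have hrow : ∀ w, ∃ a b q, q ≠ w ∧ a * a = 1 ∧ b * b = 1 ∧
      (N.submatrix id τ) w = Pi.single w a + Pi.single q b := fun w => by
    refine exists_eq_single_add_single ?_ (hτ w)
    have := hA.2 w
    rw [← hgram] at this
    exact this
  choose a b f hf ha hb hN using hrow
  have hNt : N.submatrix id τ = arrowMatrix id f a b := by
    ext w q; rw [hN]; rfl
  have hmul : ∀ z v, (N *ᵥ (z ∘ τ.symm)) v = a v * z v + b v * z (f v) := by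
    intro z v
    have := arrowMatrix_mulVec (i := id) (f := f) (a := a) (b := b) z v
    rw [← hNt, submatrix_mulVec_equiv] at this
    exact this
  refine ⟨f, a, b, ha, hb, hf, ?_, ?_, by rw [← hNt, hgram]; exact hA, ?_⟩
  · intro S hS u v hu
    classical
    -- The indicator of a union of components is even on every row, whatever the signs, hence even
    -- on the simple roots; so it is constant modulo 2.
    let z : V → ℤ := fun w => if w ∈ S then 1 else 0
    have h2 : ∀ w, (2 : ℤ) ∣ (N *ᵥ (z ∘ τ.symm)) w := by
      intro w
      rw [hmul]
      have h3 : z (f w) = z w := by simp [z, ← hS w]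
      rw [h3, ← add_mul]
      refine Dvd.dvd.mul_right ?_ _
      rcases mul_self_eq_one_iff.1 (ha w) with h | h <;>
        rcases mul_self_eq_one_iff.1 (hb w) with h' | h' <;> rw [h, h'] <;> norm_num
    have h3 : ∀ i, (2 : ℤ) ∣ (rootD n *ᵥ (z ∘ τ.symm)) i := by
      intro i
      rw [hM', ← mulVec_mulVec]
      exact Finset.dvd_sum fun w _ => (h2 w).mul_left _
    have h4 := modEq_of_rootD_mulVec h3 (τ u) (τ v)
    by_contra hv
    simp [z, hu, hv] at h4
  · intro z hz
    have h1 : N *ᵥ (z ∘ τ.symm) = 0 := funext fun v => by rw [hmul, hz, Pi.zero_apply]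
    funext v
    simpa using congrFun (hker₀ _ h1) (τ v)
  · rw [hG]
    congr 1
    rw [← hNt, hgram]

-- An integer and its square have the same parity, so vectors of norm 2 lie in the 𝔻 lattice
-- automatically.
omit [DecidableEq V] in
theorem even_sum_of_dotProduct_self {r : V → ℤ} (h : r ⬝ᵥ r = 2) : Even (∑ q, r q) := by
  have h1 : Even (∑ q, r q * (r q - 1)) :=
    Finset.even_sum _ fun q _ => Int.even_mul_pred_self _
  have h2 : ∑ q, r q * (r q - 1) = 2 - ∑ q, r q := by
    rw [← h, dotProduct, ← Finset.sum_sub_distrib]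
    exact Finset.sum_congr rfl fun q _ => by ring
  rw [h2] at h1
  have := (Int.even_sub.1 h1).1 even_two
  exact this

theorem hasDynkinType_D_of_span (hV : 3 ≤ Fintype.card V) {N : Matrix V V ℤ}
    (hA : IsQuasiCartan (N * Nᵀ)) {p : V}
    (h : ∀ q, (Pi.single q 1 - Pi.single p 1 : V → ℤ) ∈ Submodule.span ℤ (Set.range N))
    (h2 : (Pi.single p 2 : V → ℤ) ∈ Submodule.span ℤ (Set.range N)) :
    (Bigraph.ofMatrix _ hA).HasDynkinType (CartanMatrix.D (Fintype.card V)) := by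
  let τ : V ≃ Fin (Fintype.card V) := Fintype.equivFin V
  have hgram : N * Nᵀ = (N.submatrix id τ.symm) * (N.submatrix id τ.symm)ᵀ := by
    rw [transpose_submatrix, submatrix_mul_equiv N Nᵀ id τ.symm id, submatrix_id_id]
  have hsum : ∀ v, ∑ q, (N.submatrix id τ.symm) v q = ∑ q, N v q := fun v =>
    τ.symm.sum_comp (N v)
  obtain ⟨M, hM⟩ : ∃ M, N.submatrix id τ.symm = M * rootD (Fintype.card V) :=
    exists_mul_of_rows_mem_span fun v => mem_span_rootD (by omega)
      (by rw [hsum]; exact even_sum_of_dotProduct_self (hA.2 v))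
  obtain ⟨M', hM'⟩ : ∃ M', (rootD (Fintype.card V)).submatrix id τ = M' * N :=
    exists_mul_of_rows_mem_span fun i => mem_of_even_sum h h2 (by
      have : ∑ q, (rootD (Fintype.card V)).submatrix id τ i q = ∑ q, rootD _ i q :=
        τ.sum_comp (rootD _ i)
      rw [this]; exact even_sum_rootD i)
  have hM'' : rootD (Fintype.card V) = M' * N.submatrix id τ.symm := by
    have := congrArg (fun X => X.submatrix id τ.symm) hM'
    simpa [submatrix_submatrix, Matrix.submatrix_mul _ _ _ id _ Function.bijective_id] using this
  exact hasDynkinType_of_realization (rootD_gram hV) rootD_left_cancel (hA := hgram ▸ hA)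
    (by congr 1) rfl hM hM''

end TypeD

/-! ### Signed edge counts -/

section SignedCount

variable {V : Type*}

theorem ofMatrix_dotted_sub_solid {A : Matrix V V ℤ} (hA : IsQuasiCartan A) {u v : V}
    (huv : u ≠ v) : ((Bigraph.ofMatrix A hA).edges .dotted u v : ℤ) -
      (Bigraph.ofMatrix A hA).edges .solid u v = A u v := by
  by_cases h : 0 < A u v
  · simp [Bigraph.ofMatrix, huv, h, h.le]
  · simp [Bigraph.ofMatrix, huv, h, abs_of_nonpos (not_lt.1 h)]

theorem ofMatrix_edges_pos_style {A : Matrix V V ℤ} (hA : IsQuasiCartan A) {u v : V}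
    {c : LineStyle} (h : 0 < (Bigraph.ofMatrix A hA).edges c u v) :
    c = LineStyle.dotted ↔ 0 < A u v := by
  by_cases huv : u = v
  · simp [huv, Bigraph.loopless] at h
  · by_cases h0 : 0 < A u v <;> cases c <;> simp [Bigraph.ofMatrix, huv, h0] at h ⊢

/-- After cancellation only the difference of the dotted and solid multiplicities is left, and this
difference is additive under unions. -/
theorem simplify_eq_ofMatrix (G : Bigraph V) {A : Matrix V V ℤ} (hA : IsQuasiCartan A)
    (h : ∀ u v, u ≠ v → (G.edges .dotted u v : ℤ) - G.edges .solid u v = A u v) :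
    G.simplify = Bigraph.ofMatrix A hA := by
  ext c u v
  by_cases huv : u = v
  · subst huv; simp [Bigraph.loopless]
  · have := h u v huv
    by_cases h0 : 0 < A u v <;> cases c <;>
      simp [Bigraph.simplify, Bigraph.ofMatrix, LineStyle.opposite, huv, h0] <;> omega

theorem union_dotted_sub_solid {ι : Type*} [Fintype ι] {W : ι → Set V}
    {A : ∀ i, Matrix (W i) (W i) ℤ} (hA : ∀ i, IsQuasiCartan (A i)) {u v : V} (huv : u ≠ v) :
    ((Bigraph.union W fun i => Bigraph.ofMatrix (A i) (hA i)).edges .dotted u v : ℤ) -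
      (Bigraph.union W fun i => Bigraph.ofMatrix (A i) (hA i)).edges .solid u v =
    ∑ i, open Classical in
      if h : u ∈ W i ∧ v ∈ W i then A i ⟨u, h.1⟩ ⟨v, h.2⟩ else 0 := by
  simp only [Bigraph.union]
  push_cast
  rw [← Finset.sum_sub_distrib]
  refine Finset.sum_congr rfl fun i _ => ?_
  split_ifs with h
  · exact ofMatrix_dotted_sub_solid (hA i) (fun h' => huv (congrArg Subtype.val h'))
  · simp

end SignedCount

/-! ### Rooted trees arranged in a cycle -/

/-- Rooted trees with edge sets `W i`, arranged in a cycle: the edges `x i` and `x (next i)` of the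
`i`-th tree join a leaf to the root, and different trees share only such edges. -/
structure TreeCycle (V ι : Type*) where
  W : ι → Set V
  x : ι → V
  next : Equiv.Perm ι
  -- The tree that supplies the column of a vertex in the glued matrix. The vertex `x (next i)`,
  -- which lies in two trees, is assigned to the `i`-th.
  part : V → ι
  f : ∀ i, W i → Option (W i)
  a : ∀ i, W i → ℤ
  b : ∀ i, W i → ℤ
  x_injective : Function.Injective x
  next_ne : ∀ i, next i ≠ i
  x_mem : ∀ i, x i ∈ W i
  y_mem : ∀ i, x (next i) ∈ W i
  part_eq : ∀ p i, part p = i ↔ p ∈ W i ∧ p ≠ x i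
  f_x : ∀ i, f i ⟨x i, x_mem i⟩ = none
  f_y : ∀ i, f i ⟨x (next i), y_mem i⟩ = none
  f_ne_x : ∀ i w, f i w ≠ some ⟨x i, x_mem i⟩
  f_ne_y : ∀ i w, f i w ≠ some ⟨x (next i), y_mem i⟩
  wf : ∀ i, WellFounded fun u w => f i w = some u
  a_mul_a : ∀ i w, a i w * a i w = 1
  b_mul_b : ∀ i w, b i w * b i w = 1

namespace TreeCycle

variable {V ι : Type*} (C : TreeCycle V ι)

theorem part_y (i : ι) : C.part (C.x (C.next i)) = i :=
  (C.part_eq _ _).2 ⟨C.y_mem i, fun h => C.next_ne i (C.x_injective h)⟩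

theorem mem_part (p : V) : p ∈ C.W (C.part p) := ((C.part_eq p _).1 rfl).1

theorem mem_W_iff_of_ne {u : V} (hu : ∀ i, u ≠ C.x i) (i : ι) : u ∈ C.W i ↔ C.part u = i := by
  simp [C.part_eq, hu i]

theorem x_mem_W_iff (i j : ι) : C.x (C.next i) ∈ C.W j ↔ j = i ∨ j = C.next i := by
  constructor
  · intro h
    by_cases hj : C.x (C.next i) = C.x j
    · exact .inr (C.x_injective hj).symm
    · exact .inl (((C.part_eq _ _).2 ⟨h, hj⟩).symm.trans (C.part_y i))
  · rintro (rfl | rfl)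
    · exact C.y_mem _
    · exact C.x_mem _

/-- The vertex `p` as a coordinate of the `i`-th tree, whose root is `x (next i)`. -/
def coord [DecidableEq V] (i : ι) (p : V) (hp : p ∈ C.W i) : Option (C.W i) :=
  if p = C.x (C.next i) then none else some ⟨p, hp⟩

/-- The vertex that corresponds to a coordinate of the `i`-th tree. -/
def toVertex (i : ι) (q : Option (C.W i)) : V :=
  q.elim (C.x (C.next i)) Subtype.val

variable [DecidableEq V]

/-- The excluded coordinate is the leaf of `x (next i)`; the vertex `x (next i)` stands for the root
instead. -/
theorem coord_eq_iff {i : ι} {p : V} {hp : p ∈ C.W i} {q : Option (C.W i)}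
    (hq : q ≠ some ⟨C.x (C.next i), C.y_mem i⟩) : C.coord i p hp = q ↔ p = C.toVertex i q := by
  unfold coord toVertex
  cases q with
  | none => simp
  | some w =>
    have hw : w.1 ≠ C.x (C.next i) := fun h => hq (by rw [Option.some.injEq]; exact Subtype.ext h)
    by_cases hp' : p = C.x (C.next i)
    · simp [hp', hw.symm]
    · simp [hp', Subtype.ext_iff]

/-- The matrix of the `i`-th tree. -/
abbrev tree (i : ι) : Matrix (C.W i) (Option (C.W i)) ℤ := treeMatrix (C.f i) (C.a i) (C.b i)

open Classical in
/-- The entries of the matrix of the `i`-th tree, indexed by vertices. -/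
noncomputable def entry (i : ι) (u p : V) : ℤ :=
  if h : u ∈ C.W i ∧ p ∈ C.W i then C.tree i ⟨u, h.1⟩ (C.coord i p h.2) else 0

/-- The matrix whose rows are the vectors of all trees, glued along the cycle. -/
noncomputable def glue : Matrix V V ℤ := of fun u p => C.entry (C.part p) u p

theorem glue_apply (u p : V) : C.glue u p = C.entry (C.part p) u p := rfl

theorem entry_eq_zero {i : ι} {u p : V} (hu : u ∉ C.W i) : C.entry i u p = 0 :=
  dif_neg fun h => hu h.1

theorem entry_eq {i : ι} {u p : V} (hu : u ∈ C.W i) (hp : p ∈ C.W i) :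
    C.entry i u p = C.tree i ⟨u, hu⟩ (C.coord i p hp) := dif_pos ⟨hu, hp⟩

/-- An edge off the cycle belongs to one tree and touches no deleted leaf, so it keeps both ends. -/
theorem glue_apply_of_ne {u : V} (hu : ∀ i, u ≠ C.x i) (p : V) :
    C.glue u p = (if p = u then C.a (C.part u) ⟨u, C.mem_part u⟩ else 0) +
      if p = C.toVertex (C.part u) (C.f (C.part u) ⟨u, C.mem_part u⟩) then
        C.b (C.part u) ⟨u, C.mem_part u⟩ else 0 := by
  rw [glue_apply]
  by_cases hp : C.part u = C.part p
  · have hmem : p ∈ C.W (C.part u) := hp ▸ C.mem_part p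
    have hne : (some ⟨u, C.mem_part u⟩ : Option (C.W (C.part u))) ≠
        some ⟨C.x (C.next (C.part u)), C.y_mem _⟩ := by
      simpa using hu _
    rw [← hp, C.entry_eq (C.mem_part u) hmem, tree, treeMatrix, arrowMatrix_apply]
    simp only [C.coord_eq_iff hne, C.coord_eq_iff (C.f_ne_y _ _)]
    rfl
  · have h1 : u ∉ C.W (C.part p) := fun h => hp ((C.mem_W_iff_of_ne hu _).1 h)
    have h2 : p ≠ u := fun h => hp (h ▸ rfl)
    have h3 : p ≠ C.toVertex (C.part u) (C.f (C.part u) ⟨u, C.mem_part u⟩) := by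
      intro h
      apply hp
      rw [h]
      cases hf : C.f (C.part u) ⟨u, C.mem_part u⟩ with
      | none => exact (C.part_y _).symm
      | some w =>
        refine ((C.part_eq _ _).2 ⟨w.2, fun hw => C.f_ne_x _ _ (hf.trans ?_)⟩).symm
        rw [Option.some.injEq]
        exact Subtype.ext hw
    rw [C.entry_eq_zero h1, if_neg h2, if_neg h3, add_zero]

theorem glue_apply_of_mem {u : V} (hu : ∀ i, u ≠ C.x i) {i : ι} (hi : u ∈ C.W i) (p : V) :
    C.glue u p = (if p = u then C.a i ⟨u, hi⟩ else 0) +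
      if p = C.toVertex i (C.f i ⟨u, hi⟩) then C.b i ⟨u, hi⟩ else 0 := by
  obtain rfl := (C.mem_W_iff_of_ne hu i).1 hi
  exact C.glue_apply_of_ne hu p

/-- A cycle edge belongs to two trees. In each it loses the leaf and keeps the root entry, so it
joins the two roots. -/
theorem glue_apply_x (i : ι) (p : V) :
    C.glue (C.x (C.next i)) p =
      (if p = C.x (C.next i) then C.b i ⟨_, C.y_mem i⟩ else 0) +
      if p = C.x (C.next (C.next i)) then C.b (C.next i) ⟨_, C.x_mem _⟩ else 0 := by
  rw [glue_apply]
  by_cases h : C.x (C.next i) ∈ C.W (C.part p)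
  · rcases (C.x_mem_W_iff _ _).1 h with h1 | h1
    · have hmem : p ∈ C.W i := h1 ▸ C.mem_part p
      have h2 : p ≠ C.x (C.next (C.next i)) := by
        rintro rfl
        rw [C.part_y] at h1
        exact C.next_ne i h1
      rw [h1, C.entry_eq (C.y_mem i) hmem, tree, treeMatrix, arrowMatrix_apply, if_neg h2,
        C.f_y, if_neg, zero_add, add_zero]
      · simp only [C.coord_eq_iff (Option.some_ne_none _).symm]; rfl
      · unfold coord; split_ifs with h3 <;> simp [h3]
    · have hmem : p ∈ C.W (C.next i) := h1 ▸ C.mem_part p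
      have h2 : p ≠ C.x (C.next i) := ((C.part_eq _ _).1 h1).2
      rw [h1, C.entry_eq (C.x_mem _) hmem, tree, treeMatrix, arrowMatrix_apply, if_neg h2,
        C.f_x, if_neg, zero_add, zero_add]
      · simp only [C.coord_eq_iff (Option.some_ne_none _).symm]; rfl
      · unfold coord; split_ifs with h3 <;> simp [h2]
  · rw [C.entry_eq_zero h, if_neg, if_neg, add_zero]
    · rintro rfl
      exact h (by rw [C.part_y]; exact C.x_mem _)
    · rintro rfl
      exact h (by rw [C.part_y]; exact C.y_mem _)

theorem glue_dotProduct_self [Fintype V] (u : V) : C.glue u ⬝ᵥ C.glue u = 2 := by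
  have key : ∀ {q : V} {s t : ℤ}, q ≠ u → s * s = 1 → t * t = 1 →
      (∀ p, C.glue u p = (if p = u then s else 0) + if p = q then t else 0) →
      C.glue u ⬝ᵥ C.glue u = 2 := by
    intro q s t hq hs ht h
    have : C.glue u = Pi.single u s + Pi.single q t := by
      ext p; rw [h]; simp [Pi.single_apply]
    rw [this]
    simp [hq, hq.symm, hs, ht]
  by_cases hu : ∀ i, u ≠ C.x i
  · refine key ?_ (C.a_mul_a _ _) (C.b_mul_b _ _) (C.glue_apply_of_ne hu)
    cases hf : C.f (C.part u) ⟨u, C.mem_part u⟩ with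
    | none => exact (hu _).symm
    | some w =>
      intro h
      refine parent_ne (C.wf (C.part u)) ⟨u, C.mem_part u⟩ (hf.trans ?_)
      rw [Option.some.injEq]
      exact Subtype.ext h
  · push Not at hu
    obtain ⟨i, rfl⟩ := hu
    obtain ⟨i, rfl⟩ := C.next.surjective i
    exact key (fun h => C.next_ne _ (C.x_injective h)) (C.b_mul_b _ _) (C.b_mul_b _ _)
      (C.glue_apply_x i)

theorem tree_isQuasiCartan (i : ι) [Fintype (C.W i)] :
    IsQuasiCartan (C.tree i * (C.tree i)ᵀ) :=
  isQuasiCartan_arrowMatrix (parent_ne (C.wf i)) (C.a_mul_a i) (C.b_mul_b i)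

theorem sum_entry_mul_entry [Fintype V] [DecidableEq ι] [∀ i, Fintype (C.W i)] (i : ι) {u v : V}
    (huv : u ≠ v) :
    ∑ p with C.part p = i, C.entry i u p * C.entry i v p =
      open Classical in
      if h : u ∈ C.W i ∧ v ∈ C.W i then
        (C.tree i * (C.tree i)ᵀ) ⟨u, h.1⟩ ⟨v, h.2⟩ else 0 := by
  classical
  split_ifs with h
  · obtain ⟨hu, hv⟩ := h
    set t : C.W i → ℤ := fun w => C.tree i ⟨u, hu⟩ (some w) * C.tree i ⟨v, hv⟩ (some w) with ht
    set c : ℤ := C.tree i ⟨u, hu⟩ none * C.tree i ⟨v, hv⟩ none with hc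
    have hRHS : (C.tree i * (C.tree i)ᵀ) ⟨u, hu⟩ ⟨v, hv⟩ = c + ∑ w, t w := by
      rw [Matrix.mul_apply, Fintype.sum_option]; rfl
    -- A coordinate that is no parent occurs in only one row. This applies to the two deleted
    -- leaves.
    have hzero : ∀ z : C.W i, (∀ w, C.f i w ≠ some z) → t z = 0 := by
      intro z hz
      by_cases hzu : (⟨u, hu⟩ : C.W i) = z
      · have hzv : z ≠ ⟨v, hv⟩ := fun h => huv (congrArg Subtype.val (hzu.trans h))
        have : C.tree i ⟨v, hv⟩ (some z) = 0 := by
          rw [tree, treeMatrix, arrowMatrix_apply, if_neg (by simpa using hzv),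
            if_neg (hz _).symm, add_zero]
        simp [ht, this]
      · have : C.tree i ⟨u, hu⟩ (some z) = 0 := by
          rw [tree, treeMatrix, arrowMatrix_apply, if_neg (by simpa using Ne.symm hzu),
            if_neg (hz _).symm, add_zero]
        simp [ht, this]
    have htx := hzero _ (C.f_ne_x i)
    have hty := hzero _ (C.f_ne_y i)
    have hxy : C.x (C.next i) ≠ C.x i := fun h => C.next_ne i (C.x_injective h)
    have hLHS : ∑ p with C.part p = i, C.entry i u p * C.entry i v p =
        ∑ w : C.W i, if w.1 = C.x i then 0 else C.entry i u w * C.entry i v w := by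
      have := Finset.sum_subtype (p := (· ∈ C.W i)) (F := inferInstanceAs (Fintype (C.W i)))
        (Finset.univ.filter (· ∈ C.W i)) (by simp)
        fun p => if p = C.x i then 0 else C.entry i u p * C.entry i v p
      refine Eq.trans ?_ this
      rw [Finset.sum_filter, Finset.sum_filter]
      refine Finset.sum_congr rfl fun p _ => ?_
      by_cases h1 : p ∈ C.W i <;> by_cases h2 : p = C.x i <;> simp [C.part_eq, h1, h2]
    -- The root contribution `c` is booked at `x (next i)`, the vertex that carries the root column.
    rw [hLHS, hRHS, ← Fintype.sum_ite_eq (⟨C.x (C.next i), C.y_mem i⟩ : C.W i) (fun _ => c),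
      ← Finset.sum_add_distrib]
    refine Finset.sum_congr rfl fun w _ => ?_
    rw [C.entry_eq hu w.2, C.entry_eq hv w.2]
    by_cases h1 : w = ⟨C.x (C.next i), C.y_mem i⟩
    · subst h1
      simp [hxy, coord, hty, hc]
    · have h1' : w.1 ≠ C.x (C.next i) := fun h => h1 (Subtype.ext h)
      by_cases h2 : w = ⟨C.x i, C.x_mem i⟩
      · subst h2
        simp [htx, hxy]
      · have h2' : w.1 ≠ C.x i := fun h => h2 (Subtype.ext h)
        simp [h2', h1', coord, Ne.symm h1, ht]
  · refine Finset.sum_eq_zero fun p _ => ?_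
    rw [not_and_or] at h
    rcases h with h | h <;> simp [C.entry_eq_zero h]

theorem glue_gram [Fintype V] [Fintype ι] [∀ i, Fintype (C.W i)] {u v : V} (huv : u ≠ v) :
    (C.glue * C.glueᵀ) u v = ∑ i, open Classical in
      if h : u ∈ C.W i ∧ v ∈ C.W i then
        (C.tree i * (C.tree i)ᵀ) ⟨u, h.1⟩ ⟨v, h.2⟩ else 0 := by
  classical
  rw [Matrix.mul_apply, ← Finset.sum_fiberwise Finset.univ C.part]
  refine Finset.sum_congr rfl fun i _ => ?_
  rw [← C.sum_entry_mul_entry i huv]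
  refine Finset.sum_congr rfl fun p hp => ?_
  rw [← (Finset.mem_filter.1 hp).2]
  rfl

theorem simplify_union [Fintype V] [Fintype ι] [∀ i, Fintype (C.W i)]
    (hA : IsQuasiCartan (C.glue * C.glueᵀ)) :
    (Bigraph.union C.W fun i => Bigraph.ofMatrix _ (C.tree_isQuasiCartan i)).simplify =
      Bigraph.ofMatrix _ hA :=
  simplify_eq_ofMatrix _ _ fun _ _ huv =>
    (union_dotted_sub_solid (fun i => C.tree_isQuasiCartan i) huv).trans (C.glue_gram huv).symm

end TreeCycle

/-! ### Cyclic successor and products of signs -/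

theorem finRotate_ne {h : ℕ} (hh : 2 ≤ h) (i : Fin h) : finRotate h i ≠ i := by
  obtain ⟨k, rfl⟩ : ∃ k, h = k + 2 := ⟨h - 2, by omega⟩
  rw [finRotate_apply]
  simp

theorem finRotate_ofNat (k j : ℕ) :
    finRotate (k + 1) (Fin.ofNat (k + 1) j) = Fin.ofNat (k + 1) (j + 1) := by
  rw [finRotate_apply]
  ext
  simp [Fin.val_add]

theorem prod_ite_neg_one {ι : Type*} [Fintype ι] (p : ι → Prop) [DecidablePred p] :
    ∏ i, (if p i then (-1 : ℤ) else 1) = (-1) ^ (Finset.univ.filter p).card := by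
  rw [Finset.prod_ite, Finset.prod_const, Finset.prod_const_one, mul_one]

/-! ### Gluings along odd cycles have type `𝔻` -/

section Lattice

variable {P : Type*} [DecidableEq P]

/-- Since `1 + a * b` is even, a wrong sign costs a multiple of `Pi.single w 2`. Membership thus
spreads along an edge regardless of its signs. -/
theorem single_mem_step {L : Submodule ℤ (P → ℤ)} {a b : ℤ} {v w p : P} (ha : a * a = 1)
    (hb : b * b = 1) (hvw : (Pi.single v a + Pi.single w b : P → ℤ) ∈ L)
    (hw : (Pi.single w 1 - Pi.single p 1 : P → ℤ) ∈ L ∧ (Pi.single w 2 : P → ℤ) ∈ L) :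
    (Pi.single v 1 - Pi.single p 1 : P → ℤ) ∈ L ∧ (Pi.single v 2 : P → ℤ) ∈ L := by
  obtain ⟨k, hk⟩ : ∃ k, 1 + a * b = 2 * k := by
    rcases mul_self_eq_one_iff.1 ha with rfl | rfl <;>
      rcases mul_self_eq_one_iff.1 hb with rfl | rfl
    exacts [⟨1, by norm_num⟩, ⟨0, by norm_num⟩, ⟨0, by norm_num⟩, ⟨1, by norm_num⟩]
  constructor
  · have : (Pi.single v 1 - Pi.single p 1 : P → ℤ) = a • (Pi.single v a + Pi.single w b) +
        (Pi.single w 1 - Pi.single p 1) - k • Pi.single w 2 := by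
      ext q
      simp only [Pi.add_apply, Pi.sub_apply, Pi.smul_apply, Pi.single_apply, smul_eq_mul]
      split_ifs <;> linarith
    rw [this]
    exact L.sub_mem (L.add_mem (L.smul_mem _ hvw) hw.1) (L.smul_mem _ hw.2)
  · have : (Pi.single v 2 : P → ℤ) =
        (2 * a) • (Pi.single v a + Pi.single w b) - (a * b) • Pi.single w 2 := by
      ext q
      simp only [Pi.add_apply, Pi.sub_apply, Pi.smul_apply, Pi.single_apply, smul_eq_mul]
      split_ifs <;> linarith
    rw [this]
    exact L.sub_mem (L.smul_mem _ hvw) (L.smul_mem _ hw.2)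

end Lattice

namespace TreeCycle

variable {V : Type*} [Fintype V] [DecidableEq V]

-- Modulo the lattice, each cycle edge replaces a unit vector by plus or minus the next one. A full
-- turn has total sign -1, so the unit vector at `x 0` is congruent to its negative.
omit [Fintype V] in
theorem single_two_mem_span {k : ℕ} (C : TreeCycle V (Fin (k + 1)))
    (hnext : C.next = finRotate (k + 1))
    (hprod : ∏ i, -(C.b i ⟨C.x i, C.x_mem i⟩ * C.b i ⟨C.x (C.next i), C.y_mem i⟩) = -1) :
    (Pi.single (C.x 0) 2 : V → ℤ) ∈ Submodule.span ℤ (Set.range C.glue) := by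
  set L := Submodule.span ℤ (Set.range C.glue)
  -- The entry of row `x i` at the root of the preceding tree. The default 0 is never taken; it only
  -- avoids a transport along `next (next.symm i) = i`.
  let α : Fin (k + 1) → ℤ := fun i =>
    open Classical in
    if h : C.x i ∈ C.W (C.next.symm i) then C.b (C.next.symm i) ⟨C.x i, h⟩ else 0
  let β : Fin (k + 1) → ℤ := fun i => C.b i ⟨C.x i, C.x_mem i⟩
  have hαn : ∀ i, α (C.next i) = C.b i ⟨C.x (C.next i), C.y_mem i⟩ := by
    intro i
    have h : ∀ j, j = i → ∀ h : C.x (C.next i) ∈ C.W j,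
        C.b j ⟨C.x (C.next i), h⟩ = C.b i ⟨C.x (C.next i), C.y_mem i⟩ := by
      rintro _ rfl _; rfl
    have hmem : C.x (C.next i) ∈ C.W (C.next.symm (C.next i)) := by
      rw [Equiv.symm_apply_apply]; exact C.y_mem i
    exact (dif_pos hmem).trans (h _ (Equiv.symm_apply_apply _ _) hmem)
  have hα : ∀ i, α i * α i = 1 := fun i => by
    obtain ⟨i, rfl⟩ := C.next.surjective i
    rw [hαn]; exact C.b_mul_b _ _
  have hrow : ∀ i, (Pi.single (C.x i) (α i) + Pi.single (C.x (C.next i)) (β i) : V → ℤ) ∈ L := by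
    intro i
    have : C.glue (C.x i) = Pi.single (C.x i) (α i) + Pi.single (C.x (C.next i)) (β i) := by
      obtain ⟨i, rfl⟩ := C.next.surjective i
      ext p
      rw [C.glue_apply_x, ← hαn]
      simp [Pi.single_apply, β]
    rw [← this]
    exact Submodule.subset_span ⟨_, rfl⟩
  let s : Fin (k + 1) → ℤ := fun i => -(α i * β i)
  have hs : ∏ i, s i = -1 := by
    rw [← hprod]
    have h1 : ∏ i, α i = ∏ i, C.b i ⟨C.x (C.next i), C.y_mem i⟩ := by
      rw [← Equiv.prod_comp C.next α]
      exact Finset.prod_congr rfl fun i _ => hαn i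
    simp only [s, Finset.prod_neg, Finset.prod_mul_distrib, h1]
    rw [mul_comm (∏ i, C.b i ⟨C.x (C.next i), C.y_mem i⟩)]
  have hiter : ∀ j, (Pi.single (C.x 0) 1 -
      Pi.single (C.x (Fin.ofNat (k + 1) j)) (∏ m ∈ Finset.range j, s (Fin.ofNat (k + 1) m)) : V → ℤ) ∈ L := by
    intro j
    induction j with
    | zero => simp
    | succ j ih =>
      have h1 := hrow (Fin.ofNat (k + 1) j)
      have h2 : C.next (Fin.ofNat (k + 1) j) = Fin.ofNat (k + 1) (j + 1) := by
        rw [hnext, finRotate_ofNat]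
      rw [h2] at h1
      have h3 := L.add_mem ih
        (L.smul_mem ((∏ m ∈ Finset.range j, s (Fin.ofNat (k + 1) m)) * α (Fin.ofNat (k + 1) j)) h1)
      convert h3 using 1
      ext q
      simp only [Pi.add_apply, Pi.sub_apply, Pi.smul_apply, Pi.single_apply, smul_eq_mul,
        Finset.prod_range_succ, s]
      have h4 := hα (Fin.ofNat (k + 1) j)
      set u := ∏ m ∈ Finset.range j, -(α (Fin.ofNat (k + 1) m) * β (Fin.ofNat (k + 1) m))
      split_ifs <;> first | ring1 | linear_combination -u * h4
  have h := hiter (k + 1)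
  have h0 : Fin.ofNat (k + 1) (k + 1) = 0 := by ext; simp
  have hp : ∏ m ∈ Finset.range (k + 1), s (Fin.ofNat (k + 1) m) = -1 := by
    rw [← hs, ← Fin.prod_univ_eq_prod_range (fun m => s (Fin.ofNat (k + 1) m))]
    simp
  rw [h0, hp] at h
  convert h using 1
  ext q
  simp only [Pi.sub_apply, Pi.single_apply]
  split_ifs <;> norm_num

/-- `single_mem_step` spreads membership from `x 0` around the cycle and then from each root
outwards. -/
theorem hasDynkinType_D {h : ℕ} (hh : 2 ≤ h) (C : TreeCycle V (Fin h))
    (hV : 3 ≤ Fintype.card V) (hnext : C.next = finRotate h)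
    (hprod : ∏ i, -(C.b i ⟨C.x i, C.x_mem i⟩ * C.b i ⟨C.x (C.next i), C.y_mem i⟩) = -1)
    (hA : IsQuasiCartan (C.glue * C.glueᵀ)) :
    (Bigraph.ofMatrix _ hA).HasDynkinType (CartanMatrix.D (Fintype.card V)) := by
  obtain ⟨k, rfl⟩ : ∃ k, h = k + 1 := ⟨h - 1, by omega⟩
  have h2 := single_two_mem_span C hnext hprod
  set L := Submodule.span ℤ (Set.range C.glue)
  have hx : ∀ i, (Pi.single (C.x i) 1 - Pi.single (C.x 0) 1 : V → ℤ) ∈ L ∧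
      (Pi.single (C.x i) 2 : V → ℤ) ∈ L := by
    have key : ∀ j : ℕ, (Pi.single (C.x (Fin.ofNat (k + 1) j)) 1 - Pi.single (C.x 0) 1 : V → ℤ) ∈ L ∧
        (Pi.single (C.x (Fin.ofNat (k + 1) j)) 2 : V → ℤ) ∈ L := by
      intro j
      induction j with
      | zero => simpa using h2
      | succ j ih =>
        have hj : C.next (Fin.ofNat (k + 1) j) = Fin.ofNat (k + 1) (j + 1) := by
          rw [hnext, finRotate_ofNat]
        obtain ⟨i, hi⟩ := C.next.surjective (Fin.ofNat (k + 1) j)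
        rw [← hi] at ih hj
        refine single_mem_step (C.b_mul_b (C.next i) ⟨_, C.x_mem _⟩)
          (C.b_mul_b i ⟨_, C.y_mem i⟩) ?_ ih
        have : C.glue (C.x (C.next i)) ∈ L := Submodule.subset_span ⟨_, rfl⟩
        convert this using 1
        ext p
        rw [C.glue_apply_x, hj]
        simp only [Pi.add_apply, Pi.single_apply]
        ring
    intro i
    simpa using key i
  have hall : ∀ i (w : C.W i), (Pi.single w.1 1 - Pi.single (C.x 0) 1 : V → ℤ) ∈ L ∧
      (Pi.single w.1 2 : V → ℤ) ∈ L := by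
    intro i w
    induction w using (C.wf i).induction with
    | _ w ih =>
      by_cases hw : ∀ j, w.1 ≠ C.x j
      · refine single_mem_step (w := C.toVertex _ (C.f i w)) (C.a_mul_a _ w)
          (C.b_mul_b _ w) ?_ ?_
        · have : C.glue w.1 ∈ L := Submodule.subset_span ⟨_, rfl⟩
          convert this using 1
          ext p
          rw [C.glue_apply_of_mem hw w.2]
          simp [Pi.single_apply]
        · cases hf : C.f i w with
          | none => exact hx _
          | some u => exact ih u hf
      · push Not at hw
        obtain ⟨j, hj⟩ := hw
        rw [hj]
        exact hx j
  exact hasDynkinType_D_of_span hV hA (p := C.x 0) (fun q => (hall _ ⟨q, C.mem_part q⟩).1) h2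

end TreeCycle

/-- Two admissible indices for `p` would make `p` the second endpoint of two cycle edges, against
injectivity. -/
theorem exists_part {V : Type*} {H : OddCycle V} {W : Fin H.h → Set V}
    (hinter : ∀ i j, i ≠ j →
      W i ∩ W j = ({H.x i, H.next i} : Set V) ∩ ({H.x j, H.next j} : Set V))
    (hcover : ⋃ i, W i = Set.univ) (hy : ∀ i, H.next i ∈ W i) :
    ∃ part : V → Fin H.h, ∀ p i, part p = i ↔ p ∈ W i ∧ p ≠ H.x i := by
  have hex : ∀ p, ∃ i, p ∈ W i ∧ p ≠ H.x i := by
    intro p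
    obtain ⟨i, hi⟩ := Set.mem_iUnion.1 (hcover ▸ Set.mem_univ p)
    by_cases hp : p = H.x i
    · obtain ⟨j, rfl⟩ := (finRotate H.h).surjective i
      refine ⟨j, hp ▸ hy j, fun h => ?_⟩
      exact finRotate_ne H.two_le j (H.injective (hp.symm.trans h))
    · exact ⟨i, hi, hp⟩
  choose part hpart using hex
  refine ⟨part, fun p i => ⟨fun h => h ▸ hpart p, fun h => ?_⟩⟩
  by_contra hne
  have h1 : p ∈ W (part p) ∩ W i := ⟨(hpart p).1, h.1⟩
  rw [hinter _ _ hne] at h1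
  have h2 : p = H.next (part p) := h1.1.resolve_left (hpart p).2
  have h3 : p = H.next i := h1.2.resolve_left h.2
  exact hne ((finRotate H.h).injective (H.injective (h2.symm.trans h3)))

theorem hasDynkinType_D_of_isDCycleGluingOf {V : Type*} [Fintype V] (hV : 3 ≤ Fintype.card V)
    {G : Bigraph V} {H : OddCycle V} {W : Fin H.h → Set V} {F : ∀ i, Bigraph (W i)}
    (hG : IsDCycleGluingOf G H W F) :
    G.HasDynkinType (CartanMatrix.D (Fintype.card V)) := by
  classical
  have : ∀ i, Fintype (W i) := fun i => Fintype.ofFinite _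
  choose hx hy hpos hsx hsy using hG.cycle_edge
  have htree := fun i => exists_treeMatrix_of_adj (hG.dynkin_A i).choose_spec ⟨_, hpos i⟩
  choose f a b ha hb wf hfx hfy hA hF using htree
  obtain ⟨part, hpart⟩ := exists_part hG.inter hG.cover hy
  have hne : ∀ i, (⟨H.x i, hx i⟩ : W i) ≠ ⟨H.next i, hy i⟩ := fun i h =>
    finRotate_ne H.two_le i (H.injective (congrArg Subtype.val h)).symm
  let C : TreeCycle V (Fin H.h) :=
    { W := W
      x := H.x
      next := finRotate H.h
      part := part
      f := f
      a := a
      b := b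
      x_injective := H.injective
      next_ne := finRotate_ne H.two_le
      x_mem := hx
      y_mem := hy
      part_eq := hpart
      f_x := hfx
      f_y := hfy
      f_ne_x := fun i => parent_ne_of_not_isSeparationVertex (hA i) (ha i) (hb i) (wf i) (hne i)
        (hfx i) (hfy i) (hF i ▸ hsx i)
      f_ne_y := fun i => parent_ne_of_not_isSeparationVertex (hA i) (ha i) (hb i) (wf i)
        (hne i).symm (hfy i) (hfx i) (hF i ▸ hsy i)
      wf := wf
      a_mul_a := ha
      b_mul_b := hb }
  have hQ : IsQuasiCartan (C.glue * C.glueᵀ) := isQuasiCartan_gram C.glue_dotProduct_self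
  have hGC : G = Bigraph.ofMatrix _ hQ := by
    have hF' : F = fun i => Bigraph.ofMatrix _ (hA i) := funext hF
    rw [hG.eq_simplify, hF']
    exact C.simplify_union hQ
  rw [hGC]
  refine C.hasDynkinType_D H.two_le hV rfl ?_ hQ
  -- The two edges meet only at the root, so their inner product is the product of the `b`-entries.
  -- It is positive exactly for a dotted edge, which then contributes -1.
  rw [Finset.prod_congr rfl (g := fun i => if H.style i = LineStyle.dotted then (-1 : ℤ) else 1),
    prod_ite_neg_one, H.odd_dotted.neg_one_pow]
  intro i _
  have h1 := hpos i
  rw [hF i] at h1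
  have h2 := ofMatrix_edges_pos_style (hA i) h1
  rw [treeMatrix_gram, hfx, hfy, if_neg (hne i)] at h2
  simp only [reduceCtorEq, if_false, if_true, add_zero, mul_zero, zero_add] at h2
  change -(b i ⟨H.x i, hx i⟩ * b i ⟨H.next i, hy i⟩) = _
  simp only [h2]
  rcases mul_self_eq_one_iff.1 (hb i ⟨H.x i, hx i⟩) with h | h <;>
    rcases mul_self_eq_one_iff.1 (hb i ⟨H.next i, hy i⟩) with h' | h' <;> rw [h, h'] <;> norm_num

/-! ### Tree cycles with an odd number of dotted edges are `𝔻`-cycle gluings -/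

namespace TreeCycle

theorem isDCycleGluing {V : Type*} [Fintype V] [DecidableEq V] {h : ℕ} (hh : 2 ≤ h)
    (C : TreeCycle V (Fin h)) (hnext : C.next = finRotate h)
    (hprod : ∏ i, -(C.b i ⟨C.x i, C.x_mem i⟩ * C.b i ⟨C.x (C.next i), C.y_mem i⟩) = -1)
    (hA : IsQuasiCartan (C.glue * C.glueᵀ)) :
    IsDCycleGluing (Bigraph.ofMatrix _ hA) := by
  classical
  have : ∀ i, Fintype (C.W i) := fun i => Fintype.ofFinite _
  let β : Fin h → ℤ := fun i => C.b i ⟨C.x i, C.x_mem i⟩ * C.b i ⟨C.x (C.next i), C.y_mem i⟩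
  have hβ : ∀ i, β i = 1 ∨ β i = -1 := by
    intro i
    rw [← mul_self_eq_one_iff]
    have h1 := C.b_mul_b i ⟨C.x i, C.x_mem i⟩
    have h2 := C.b_mul_b i ⟨C.x (C.next i), C.y_mem i⟩
    simp only [β]
    rw [mul_mul_mul_comm, h1, h2, one_mul]
  have hne : ∀ i, (⟨C.x i, C.x_mem i⟩ : C.W i) ≠ ⟨C.x (C.next i), C.y_mem i⟩ := fun i h =>
    C.next_ne i (C.x_injective (congrArg Subtype.val h)).symm
  have hgram : ∀ i, (C.tree i * (C.tree i)ᵀ) ⟨C.x i, C.x_mem i⟩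
      ⟨C.x (C.next i), C.y_mem i⟩ = β i := by
    intro i
    rw [tree, treeMatrix_gram, C.f_x, C.f_y, if_neg (hne i)]
    simp [β]
  let H : OddCycle V :=
    { h := h
      two_le := hh
      x := C.x
      injective := C.x_injective
      style := fun i => if 0 < β i then LineStyle.dotted else LineStyle.solid
      odd_dotted := by
        have h1 : ∀ i, ((if 0 < β i then LineStyle.dotted else LineStyle.solid) =
            LineStyle.dotted) ↔ 0 < β i := fun i => by split_ifs with h <;> simp [h]
        simp only [h1]
        have h2 := prod_ite_neg_one fun i => 0 < β i
        rw [Finset.prod_congr rfl (g := fun i => -β i)] at h2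
        · rw [hprod] at h2
          by_contra hodd
          rw [Nat.not_odd_iff_even] at hodd
          rw [hodd.neg_one_pow] at h2
          norm_num at h2
        · intro i _
          rcases hβ i with h | h <;> simp [h] }
  refine ⟨H, C.W, fun i => Bigraph.ofMatrix _ (C.tree_isQuasiCartan i), ?_, ?_, ?_, ?_, ?_⟩
  · exact fun i => ⟨_, hasDynkinType_treeMatrix (C.a_mul_a i) (C.b_mul_b i) (C.wf i) _⟩
  · intro i
    have hy : H.next i = C.x (C.next i) := by rw [hnext]; rfl
    have hmem : H.next i ∈ C.W i := by rw [hy]; exact C.y_mem i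
    refine ⟨C.x_mem i, hmem, ?_⟩
    have hy' : (⟨H.next i, hmem⟩ : C.W i) = ⟨C.x (C.next i), C.y_mem i⟩ := Subtype.ext hy
    rw [hy']
    refine ⟨?_, ?_, ?_⟩
    · obtain ⟨c, hc⟩ := (ofMatrix_edges_pos (hA := C.tree_isQuasiCartan i)).2 ⟨hne i, by
        rw [hgram]; rcases hβ i with h | h <;> simp [h]⟩
      have h1 := ofMatrix_edges_pos_style _ hc
      rw [hgram] at h1
      have h2 : H.style i = c := by
        change (if 0 < β i then LineStyle.dotted else LineStyle.solid) = c
        split_ifs with h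
        · exact (h1.2 h).symm
        · cases c
          · rfl
          · exact absurd (h1.1 rfl) h
      rw [h2]
      exact hc
    · exact not_isSeparationVertex_of_parent_ne _ (C.a_mul_a i) (C.b_mul_b i) (C.wf i) (hne i)
        (C.f_y i) (C.f_ne_x i)
    · exact not_isSeparationVertex_of_parent_ne _ (C.a_mul_a i) (C.b_mul_b i) (C.wf i)
        (hne i).symm (C.f_x i) (C.f_ne_y i)
  · intro i j hij
    have hsub : ∀ i j p, i ≠ j → p ∈ C.W i → p ∈ C.W j → p = C.x i ∨ p = C.x (C.next i) := by
      intro i j p hij hi hj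
      by_cases hp : ∃ k, p = C.x k
      · obtain ⟨k, rfl⟩ := hp
        obtain ⟨k, rfl⟩ := C.next.surjective k
        rcases (C.x_mem_W_iff _ _).1 hi with h | h
        · exact .inr (by rw [h])
        · exact .inl (by rw [h])
      · push Not at hp
        exact absurd (((C.mem_W_iff_of_ne hp i).1 hi).symm.trans
          ((C.mem_W_iff_of_ne hp j).1 hj)) hij
    have hnx : ∀ i, H.next i = C.x (C.next i) := fun i => by rw [hnext]; rfl
    have hmem : ∀ i p, p ∈ ({H.x i, H.next i} : Set V) → p ∈ C.W i := by
      rintro i p (rfl | h)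
      · exact C.x_mem i
      · rw [Set.mem_singleton_iff.1 h, hnx]; exact C.y_mem i
    ext p
    refine ⟨fun ⟨hi, hj⟩ => ⟨?_, ?_⟩, fun ⟨hi, hj⟩ => ⟨hmem i p hi, hmem j p hj⟩⟩
    · rw [hnx]; exact hsub i j p hij hi hj
    · rw [hnx]; exact hsub j i p hij.symm hj hi
  · exact Set.eq_univ_of_forall fun p => Set.mem_iUnion.2 ⟨_, C.mem_part p⟩
  · exact (C.simplify_union hA).symm

end TreeCycle

/-! ### Functional graphs with a single cycle as tree cycles -/

section Functional

variable {V : Type*} {f : V → V} {x₀ : V}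

/-- The cycle of the periodic point `x₀`. -/
def cyclePoint (f : V → V) (x₀ : V) (i : Fin (Function.minimalPeriod f x₀)) : V := f^[i] x₀

theorem cyclePoint_injective : Function.Injective (cyclePoint f x₀) := fun i j hij =>
  Fin.ext (Function.iterate_injOn_Iio_minimalPeriod i.2 j.2 hij)

theorem apply_cyclePoint (i : Fin (Function.minimalPeriod f x₀)) :
    f (cyclePoint f x₀ i) = cyclePoint f x₀ (finRotate _ i) := by
  have h : cyclePoint f x₀ (finRotate _ i) =
      f^[(i.val + 1) % Function.minimalPeriod f x₀] x₀ := by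
    unfold cyclePoint
    have : NeZero (Function.minimalPeriod f x₀) := i.neZero
    rw [finRotate_apply, Fin.val_add, Fin.val_one']
    simp
  rw [h, Function.iterate_mod_minimalPeriod_eq, Function.iterate_succ_apply']
  rfl

/-- The points whose orbit meets `x₀` are closed under images and preimages; periodicity handles the
image of `x₀` itself. -/
theorem exists_iterate_eq [Finite V] (hx₀ : x₀ ∈ Function.periodicPts f)
    (hconn : ∀ S : Set V, (∀ v, v ∈ S ↔ f v ∈ S) → ∀ u v, u ∈ S → v ∈ S) (v : V) :
    ∃ k, f^[k] v = x₀ := by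
  refine hconn {v | ∃ k, f^[k] v = x₀} (fun v => ⟨?_, ?_⟩) x₀ v ⟨0, rfl⟩
  · rintro ⟨k, hk⟩
    cases k with
    | zero =>
      have hv : v = x₀ := hk
      subst hv
      refine ⟨Function.minimalPeriod f v - 1, ?_⟩
      rw [← Function.iterate_succ_apply, Nat.succ_eq_add_one,
        Nat.sub_add_cancel (Function.minimalPeriod_pos_of_mem_periodicPts hx₀)]
      exact Function.isPeriodicPt_minimalPeriod f v
    | succ k => exact ⟨k, hk⟩
  · rintro ⟨k, hk⟩
    exact ⟨k + 1, hk⟩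

theorem exists_periodicPt [Finite V] [Nonempty V] (f : V → V) :
    ∃ x, x ∈ Function.periodicPts f := by
  obtain ⟨v⟩ := ‹Nonempty V›
  obtain ⟨i, j, hij, h⟩ := Finite.exists_ne_map_eq_of_infinite fun k : ℕ => f^[k] v
  wlog hlt : i < j generalizing i j
  · exact this j i hij.symm h.symm (by omega)
  refine ⟨f^[i] v, j - i, by omega, ?_⟩
  change f^[j - i] (f^[i] v) = f^[i] v
  rw [← Function.iterate_add_apply, Nat.sub_add_cancel hlt.le]
  exact h.symm

/-- A nontrivial solution of `z v = s v * z (f v)` exists if the product of the coefficients along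
the cycle is `1`. -/
theorem exists_eq_mul_apply (hx₀ : x₀ ∈ Function.periodicPts f) (hreach : ∀ v, ∃ k, f^[k] v = x₀)
    {s : V → ℤ} (hs : ∏ i, s (cyclePoint f x₀ i) = 1) :
    ∃ z : V → ℤ, (∀ v, z v = s v * z (f v)) ∧ z x₀ = 1 := by
  classical
  let e : V → ℕ := fun v => Nat.find (hreach v)
  have he : ∀ v, v ≠ x₀ → e v = e (f v) + 1 := fun v hv =>
    (Nat.find_comp_succ (hreach v) (hreach (f v)) hv)
  have he₀ : e x₀ = 0 := (Nat.find_eq_zero _).2 rfl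
  have hp := Function.minimalPeriod_pos_of_mem_periodicPts hx₀
  have he₁ : e (f x₀) + 1 = Function.minimalPeriod f x₀ := by
    refine le_antisymm ?_ ?_
    · have : e (f x₀) ≤ Function.minimalPeriod f x₀ - 1 := by
        refine Nat.find_min' _ ?_
        rw [← Function.iterate_succ_apply, Nat.succ_eq_add_one, Nat.sub_add_cancel hp]
        exact Function.isPeriodicPt_minimalPeriod f x₀
      omega
    · exact Function.IsPeriodicPt.minimalPeriod_le (Nat.succ_pos _) (Nat.find_spec (hreach (f x₀)))
  -- The product of the coefficients on the way to `x₀`. The equation holds by construction except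
  -- at `x₀`, where it is the condition on the cycle product.
  let z : V → ℤ := fun v => ∏ j ∈ Finset.range (e v), s (f^[j] v)
  have hz : ∀ v, s v * z (f v) = ∏ j ∈ Finset.range (e (f v) + 1), s (f^[j] v) := by
    intro v
    rw [Finset.prod_range_succ', mul_comm]
    rfl
  have hz₀ : z x₀ = 1 := by simp [z, he₀]
  refine ⟨z, fun v => ?_, hz₀⟩
  rw [hz]
  by_cases hv : v = x₀
  · subst hv
    rw [hz₀, he₁, ← hs, ← Fin.prod_univ_eq_prod_range fun j => s (f^[j] v)]
    rfl
  · rw [← he v hv]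

/-- A vertex is sorted by the first cycle point on its orbit, shifted by one because the `i`-th tree
is rooted at `x (next i)`. The distance `d` to the cycle makes the parent maps well-founded. -/
theorem exists_part_of_reach (hreach : ∀ v, ∃ k, f^[k] v = x₀)
    (hx₀ : x₀ ∈ Function.periodicPts f) :
    ∃ (part : V → Fin (Function.minimalPeriod f x₀)) (d : V → ℕ),
      (∀ i, part (cyclePoint f x₀ (finRotate _ i)) = i) ∧
      ∀ v, v ∉ Set.range (cyclePoint f x₀) → part (f v) = part v ∧ d (f v) < d v := by
  classical
  have hex : ∀ v, ∃ k, f^[k] v ∈ Set.range (cyclePoint f x₀) := fun v => by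
    obtain ⟨k, hk⟩ := hreach v
    exact ⟨k, ⟨0, Function.minimalPeriod_pos_of_mem_periodicPts hx₀⟩, hk.symm⟩
  let d : V → ℕ := fun v => Nat.find (hex v)
  have hd : ∀ v, v ∉ Set.range (cyclePoint f x₀) → d v = d (f v) + 1 := fun v hv =>
    Nat.find_comp_succ (hex v) (hex (f v)) hv
  choose r hr using fun v => Nat.find_spec (hex v)
  refine ⟨fun v => (finRotate _).symm (r v), d, fun i => ?_, fun v hv => ⟨?_, ?_⟩⟩
  · have h0 : d (cyclePoint f x₀ (finRotate _ i)) = 0 := (Nat.find_eq_zero _).2 ⟨_, rfl⟩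
    have h1 := hr (cyclePoint f x₀ (finRotate _ i))
    rw [show Nat.find _ = 0 from h0] at h1
    exact (Equiv.symm_apply_eq _).2 (cyclePoint_injective h1)
  · have h1 := hr v
    rw [show Nat.find _ = _ from hd v hv, Function.iterate_succ_apply, ← hr (f v)] at h1
    simp [cyclePoint_injective h1]
  · rw [hd v hv]; omega

/-- Each cycle edge is cut and becomes a leaf edge of both neighbouring trees. The `i`-th tree
collects what flows into the cycle at `x (next i)`, together with the cut edges `x i` and `x (next
i)`. -/
theorem exists_treeCycle [DecidableEq V] (hx₀ : x₀ ∈ Function.periodicPts f)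
    (hreach : ∀ v, ∃ k, f^[k] v = x₀) {a b : V → ℤ}
    (ha : ∀ v, a v * a v = 1) (hb : ∀ v, b v * b v = 1)
    (h2 : 2 ≤ Function.minimalPeriod f x₀) :
    ∃ C : TreeCycle V (Fin (Function.minimalPeriod f x₀)), C.next = finRotate _ ∧
      (∀ i, C.b i ⟨C.x i, C.x_mem i⟩ = b (cyclePoint f x₀ i)) ∧
      (∀ i, C.b i ⟨C.x (C.next i), C.y_mem i⟩ = a (cyclePoint f x₀ (finRotate _ i))) ∧
      C.glue = arrowMatrix id f a b := by
  classical
  obtain ⟨part, d, hpart, hd⟩ := exists_part_of_reach hreach hx₀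
  set x := cyclePoint f x₀ with hx
  set next := finRotate (Function.minimalPeriod f x₀) with hnext
  have hxinj : Function.Injective x := cyclePoint_injective
  have hfx : ∀ i, f (x i) = x (next i) := apply_cyclePoint
  have hnn : ∀ i, next i ≠ i := finRotate_ne h2
  have hpx : ∀ i, part (x i) ≠ i := fun i => by
    obtain ⟨i, rfl⟩ := next.surjective i
    rw [hpart]; exact (hnn i).symm
  let W : Fin (Function.minimalPeriod f x₀) → Set V := fun i => {v | v = x i ∨ part v = i}
  have hfW : ∀ i (w : W i), ¬ (w.1 ∈ Set.range x ∨ f w = x (next i)) → part (f w.1) = i := by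
    intro i w hw
    rw [not_or] at hw
    rw [(hd w.1 hw.1).1]
    exact w.2.resolve_left fun h => hw.1 ⟨i, h.symm⟩
  let F : ∀ i, W i → Option (W i) := fun i w =>
    if h : w.1 ∈ Set.range x ∨ f w = x (next i) then none else some ⟨f w, .inr (hfW i w h)⟩
  have hF : ∀ i w u, F i w = some u →
      u.1 = f w ∧ w.1 ∉ Set.range x ∧ f w ≠ x (next i) ∧ part (f w.1) = i := by
    intro i w u h
    simp only [F] at h
    split_ifs at h with hw
    rw [Option.some.injEq] at h
    have h1 := hfW i w hw
    rw [not_or] at hw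
    exact ⟨by rw [← h], hw.1, hw.2, h1⟩
  -- The edge `x (next i)` meets the root of the `i`-th tree at its own coordinate, with entry `a`;
  -- every other edge meets its parent at its `f`-end, with entry `b`.
  let B : ∀ i, W i → ℤ := fun i w => if w.1 = x (next i) then a w else b w
  let C : TreeCycle V (Fin (Function.minimalPeriod f x₀)) :=
    { W := W
      x := x
      next := next
      part := part
      f := F
      a := fun i w => a w
      b := B
      x_injective := hxinj
      next_ne := hnn
      x_mem := fun i => .inl rfl
      y_mem := fun i => .inr (hpart i)
      part_eq := fun p i => ⟨fun h => ⟨.inr h, fun hp => hpx i (hp ▸ h)⟩, fun h => h.1.resolve_left h.2⟩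
      f_x := fun i => dif_pos (.inl ⟨i, rfl⟩)
      f_y := fun i => dif_pos (.inl ⟨next i, rfl⟩)
      f_ne_x := fun i w h => by
        obtain ⟨h1, -, -, h4⟩ := hF _ _ _ h
        rw [← h1] at h4
        exact hpx i h4
      f_ne_y := fun i w h => by
        obtain ⟨h1, -, h3, -⟩ := hF _ _ _ h
        exact h3 h1.symm
      wf := fun i => Subrelation.wf (r := InvImage (· < ·) fun w : W i => d w)
        (fun {u w} h => by
          obtain ⟨h1, h2, -⟩ := hF _ _ _ h
          change d u.1 < d w.1
          rw [h1]; exact (hd _ h2).2) (InvImage.wf _ Nat.lt_wfRel.wf)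
      a_mul_a := fun i w => ha w
      b_mul_b := fun i w => by
        simp only [B]
        split_ifs
        exacts [ha _, hb _] }
  have hbx : ∀ i, C.b i ⟨C.x i, C.x_mem i⟩ = b (x i) := fun i =>
    if_neg fun h => hnn i (hxinj h).symm
  have hby : ∀ i, C.b i ⟨C.x (C.next i), C.y_mem i⟩ = a (x (next i)) := fun i => if_pos rfl
  refine ⟨C, rfl, hbx, hby, ?_⟩
  ext u p
  rw [arrowMatrix_apply]
  by_cases hu : ∀ i, u ≠ C.x i
  · rw [C.glue_apply_of_ne hu]
    have h1 : C.b (C.part u) ⟨u, C.mem_part u⟩ = b u := if_neg (hu _)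
    have h3 : u ∉ Set.range x := fun ⟨i, hi⟩ => hu i hi.symm
    have h4 : C.toVertex (C.part u) (C.f (C.part u) ⟨u, C.mem_part u⟩) = f u := by
      by_cases h5 : f u = x (next (part u))
      · have : C.f (C.part u) ⟨u, C.mem_part u⟩ = none := dif_pos (.inr h5)
        rw [this]
        exact h5.symm
      · have h6 : ¬ (u ∈ Set.range x ∨ f u = x (next (part u))) := by tauto
        have : C.f (C.part u) ⟨u, C.mem_part u⟩ =
            some ⟨f u, .inr (hfW _ ⟨u, C.mem_part u⟩ h6)⟩ := dif_neg h6
        rw [this]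
        rfl
    rw [h1, h4]
    rfl
  · push Not at hu
    obtain ⟨i, rfl⟩ := hu
    obtain ⟨i, rfl⟩ := C.next.surjective i
    rw [C.glue_apply_x, hbx, hby]
    have h5 : f (C.x (C.next i)) = C.x (C.next (C.next i)) := hfx _
    rw [h5]
    rfl

end Functional

/-! ### Both directions assembled -/

theorem isDCycleGluing_of_hasDynkinType_D {V : Type*} [Fintype V] {n : ℕ} (hn : 3 ≤ n)
    (hV : Fintype.card V = n) {G : Bigraph V} (hG : G.HasDynkinType (CartanMatrix.D n)) :
    IsDCycleGluing G := by
  classical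
  obtain ⟨f, a, b, ha, hb, hf, hconn, hker, hA, hGA⟩ := exists_arrowMatrix_of_typeD hn hG
  have : Nonempty V := Fintype.card_pos_iff.1 (by omega)
  obtain ⟨x₀, hx₀⟩ := exists_periodicPt f
  have hreach := exists_iterate_eq hx₀ hconn
  have h2 : 2 ≤ Function.minimalPeriod f x₀ := by
    have h0 := Function.minimalPeriod_pos_of_mem_periodicPts hx₀
    have h1 : Function.minimalPeriod f x₀ ≠ 1 := fun h =>
      hf x₀ (Function.minimalPeriod_eq_one_iff_isFixedPt.1 h)
    omega
  obtain ⟨C, hnext, hbx, hby, hglue⟩ := exists_treeCycle hx₀ hreach ha hb h2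
  -- The product is 1 or -1; the value 1 means a balanced cycle and would give a nonzero kernel
  -- vector.
  have hprod : ∏ i, -(a (cyclePoint f x₀ i) * b (cyclePoint f x₀ i)) = -1 := by
    have h1 : ∀ v, -(a v * b v) * -(a v * b v) = 1 := fun v => by
      rw [neg_mul_neg, mul_mul_mul_comm, ha, hb, one_mul]
    have h3 : (∏ i, -(a (cyclePoint f x₀ i) * b (cyclePoint f x₀ i))) *
        ∏ i, -(a (cyclePoint f x₀ i) * b (cyclePoint f x₀ i)) = 1 := by
      rw [← Finset.prod_mul_distrib]
      exact Finset.prod_eq_one fun i _ => h1 _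
    refine (mul_self_eq_one_iff.1 h3).resolve_left fun h4 => ?_
    obtain ⟨z, hz, hz₀⟩ := exists_eq_mul_apply (s := fun v => -(a v * b v)) hx₀ hreach h4
    have := hker z fun v => by
      rw [hz v]
      linear_combination -(b v * z (f v)) * ha v
    rw [this] at hz₀
    exact zero_ne_one hz₀
  have hprod' : ∏ i, -(C.b i ⟨C.x i, C.x_mem i⟩ * C.b i ⟨C.x (C.next i), C.y_mem i⟩) = -1 := by
    rw [← hprod]
    simp only [hbx, hby, Finset.prod_neg, Finset.prod_mul_distrib]
    rw [Equiv.prod_comp (finRotate _) fun i => a (cyclePoint f x₀ i)]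
    rw [mul_comm (∏ i, a (cyclePoint f x₀ i))]
  have hA' : IsQuasiCartan (C.glue * C.glueᵀ) := by rw [hglue]; exact hA
  have hG' : G = Bigraph.ofMatrix (C.glue * C.glueᵀ) hA' := by
    rw [hGA]; congr 1; rw [hglue]
  rw [hG']
  exact C.isDCycleGluing h2 hnext hprod' hA'

end DCycle

theorem mainTheorem2 {V : Type*} [Fintype V] (n : ℕ) (hn : 4 ≤ n) (hV : Fintype.card V = n)
    (G : Bigraph V) :
    G.HasDynkinType (CartanMatrix.D n) ↔ IsDCycleGluing G := by
  constructor
  · exact DCycle.isDCycleGluing_of_hasDynkinType_D (by omega) hV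
  · rintro ⟨H, W, F, hG⟩
    rw [← hV]
    exact DCycle.hasDynkinType_D_of_isDCycleGluingOf (by omega) hG
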